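/- Let $N,n\ge 0$ and let $\mathcal L=\sum_{i<j}L_{ij}\,dt_i\wedge dt_j$ be a Lagrangian two-form on multi-time $\mathbb R^N$ whose coefficients $L_{ij}$ are smooth functions of $t=(t_1,\dots,t_N)$ (an explicit dependence on $t$ is allowed but not required), of a field $u:\mathbb R^N\to\mathbb R$ and of its partial derivatives up to order $n$; put $L_{ji}=-L_{ij}$. For a multi-index $I=(i_1,\dots,i_N)\in\mathbb N^N$ write $u_I=\partial^{|I|}u/(\partial t_1)^{i_1}\cdots(\partial t_N)^{i_N}$, write $Ik^\alpha$ for $I$ with $i_k$ replaced by $i_k+\alpha$, $Ik=Ik^1$, and $k\notin I$ if $i_k=0$. Let $D_i=\partial_{t_i}+\sum_I u_{Ii}\,\partial/\partial u_I$ be the total derivative (the term $\partial_{t_i}$ being absent in the autonomous case) and $$\frac{\delta_{ij}L_{ij}}{\delta u_I}=\sum_{\alpha,\beta\ge0}(-1)^{\alpha+\beta}D_i^\alpha D_j^\beta\,\frac{\partial L_{ij}}{\partial u_{Ii^\alpha j^\beta}} .$$ By a surface we mean a compact oriented piecewise smooth embedded surface $S\subset\mathbb R^N$, possibly with boundary: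 a finite union of smoothly embedded oriented closed squares, more precisely an injective image of an abstract surface obtained from finitely many closed unit squares by gluing some of their edges in pairs with opposite directions, the map being a smooth immersion on each closed square. This includes compact oriented smooth surfaces and stepped surfaces, which consist of rectangles parallel to coordinate planes. A smooth field $u$ is critical on $S$ if $$\int_S\ \sum_{i<j}\Big(\sum_I\frac{\partial L_{ij}}{\partial u_I}\,v_I\Big)\,dt_i\wedge dt_j=0$$ (with $\partial L_{ij}/\partial u_I$ evaluated on $u$) for every smooth $v:\mathbb R^N\to\mathbb R$ that vanishes in a neighbourhood of the boundary $\partial S$. **Theorem.** A smooth field $u:\mathbb R^N\to\mathbb R$ is critical on every surface $S$ in $\mathbb R^N$ if and only if the following equations, evaluated on $u$, hold at every point of $\mathbb R^N$: 1. $\dfrac{\delta_{ij}L_{ij}}{\delta u_I}=0$ for all distinct $i,j$ and all $I$ with $i\notin I$ and $j\notin I$; 2. $\dfrac{\delta_{ij}L_{ij}}{\delta u_{Ij}}=\dfrac{\delta_{ik}L_{ik}}{\delta u_{Ik}}$ for all pairwise distinct $i,j,k$ and all $I$ with $i\notin I$; 3. $\dfrac{\delta_{ij}L_{ij}}{\delta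 u_{Iij}}+\dfrac{\delta_{jk}L_{jk}}{\delta u_{Ijk}}+\dfrac{\delta_{ki}L_{ki}}{\delta u_{Iki}}=0$ for all pairwise distinct $i,j,k$ and all $I$. -/

import Mathlib

open Set
open scoped ContDiff

noncomputable section

namespace PluriLagrangian

/-! ### Multi-indices, partial derivatives, jets -/

/-- Multi-time with coordinates `t_1, ..., t_N`. Only its topology and smooth structure matter. -/
abbrev MultiTime (N : ℕ) : Type := Fin N → ℝ

/-- Multi-indices `I = (i_1, ..., i_N)`. The multi-index `I k` is `I + Pi.single k 1`,
the multi-index `I k^α` is `I + Pi.single k α`, and `k ∉ I` means `I k = 0`. -/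
abbrev MultiIndex (N : ℕ) : Type := Fin N → ℕ

/-- The partial derivative `∂g/∂t_i`. -/
def partialD {N : ℕ} (i : Fin N) (g : MultiTime N → ℝ) : MultiTime N → ℝ :=
  fun t => fderiv ℝ g t (Pi.single i 1)

/-- The iterated partial derivative
`u_I = ∂^{|I|} u / (∂t_1)^{i_1} ... (∂t_N)^{i_N}`. -/
def partialDeriv {N : ℕ} (I : MultiIndex N) (u : MultiTime N → ℝ) : MultiTime N → ℝ :=
  (List.finRange N).foldr (fun i g => (partialD i)^[I i] g) u

/-- Values of all the jet coordinates `u_I`. -/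
abbrev JetFiber (N : ℕ) : Type := MultiIndex N → ℝ

/-- The jet of the field `u` at the point `t`. -/
def jet {N : ℕ} (u : MultiTime N → ℝ) (t : MultiTime N) : JetFiber N :=
  fun I => partialDeriv I u t

/-- The finite set of the multi-indices `I` with `|I| ≤ n`. -/
def jetIndices (N n : ℕ) : Finset (MultiIndex N) :=
  (Fintype.piFinset fun _ : Fin N => Finset.range (n + 1)).filter fun I => ∑ i, I i ≤ n

theorem mem_jetIndices {N n : ℕ} {I : MultiIndex N} : I ∈ jetIndices N n ↔ ∑ i, I i ≤ n := by
  refine ⟨fun h => (Finset.mem_filter.1 h).2, fun h => Finset.mem_filter.2 ⟨?_, h⟩⟩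
  refine Fintype.mem_piFinset.2 fun i => Finset.mem_range.2 (Nat.lt_succ_of_le ?_)
  exact (Finset.single_le_sum (fun j _ => Nat.zero_le (I j)) (Finset.mem_univ i)).trans h

/-- `F` is a smooth function on the `n`-th jet bundle: a smooth function of `t` and of the
finitely many jet coordinates `u_I` with `|I| ≤ n`. -/
def IsSmoothJetFunction {N : ℕ} (n : ℕ) (F : MultiTime N → JetFiber N → ℝ) : Prop :=
  ∃ G : MultiTime N × (jetIndices N n → ℝ) → ℝ,
    ContDiff ℝ ∞ G ∧ ∀ t p, F t p = G (t, fun I => p I)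

/-- The partial derivative `∂F/∂u_I` of a function on jet space. -/
def jetPartial {N : ℕ} (I : MultiIndex N) (F : MultiTime N → JetFiber N → ℝ) :
    MultiTime N → JetFiber N → ℝ :=
  fun t p => deriv (fun s : ℝ => F t (Function.update p I s)) (p I)

/-- The total derivative `D_i F = ∂F/∂t_i + ∑_I u_{I i} ∂F/∂u_I`; the first term is absent for
functions that do not depend explicitly on `t`. For a function on a jet bundle of
finite order only finitely many terms of the sum are nonzero. -/
def totalD {N : ℕ} (i : Fin N) (F : MultiTime N → JetFiber N → ℝ) :
    MultiTime N → JetFiber N → ℝ :=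
  fun t p => fderiv ℝ (fun t' => F t' p) t (Pi.single i 1)
    + ∑ᶠ I : MultiIndex N, p (I + Pi.single i 1) * jetPartial I F t p

/-- The variational derivative in the coordinate directions `i`, `j`:
`δ_{ij} F / δu_I = ∑_{α, β ≥ 0} (-1)^{α + β} D_i^α D_j^β (∂F / ∂u_{I i^α j^β})`.
For a function on a jet bundle of finite order only finitely many terms are nonzero. -/
def varDeriv {N : ℕ} (i j : Fin N) (F : MultiTime N → JetFiber N → ℝ) (I : MultiIndex N) :
    MultiTime N → JetFiber N → ℝ :=
  fun t p => ∑ᶠ ab : ℕ × ℕ, (-1 : ℝ) ^ (ab.1 + ab.2) *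
    ((totalD i)^[ab.1] ((totalD j)^[ab.2]
      (jetPartial (I + Pi.single i ab.1 + Pi.single j ab.2) F))) t p

/-! ### Lagrangian two-forms -/

/-- A smooth Lagrangian two-form `∑_{i<j} L_{ij} dt_i ∧ dt_j` on the `n`-th jet bundle, with the
convention `L_{ji} = -L_{ij}`. -/
structure LagrangianTwoForm (N n : ℕ) where
  /-- The coefficients `L_{ij}`. -/
  coeff : Fin N → Fin N → MultiTime N → JetFiber N → ℝ
  smooth : ∀ i j, IsSmoothJetFunction n (coeff i j)
  antisymm : ∀ i j t p, coeff j i t p = -coeff i j t p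

/-- The coefficient of `dt_i ∧ dt_j` in the two-form on multi-time obtained by contracting the
vertical derivative `δL` with the prolongation of the variation `v`, along the field `u`:
`∑_I (∂L_{ij}/∂u_I)[u] v_I`. -/
def LagrangianTwoForm.variation {N n : ℕ} (L : LagrangianTwoForm N n)
    (u v : MultiTime N → ℝ) (i j : Fin N) : MultiTime N → ℝ :=
  fun t => ∑ᶠ I : MultiIndex N, jetPartial I (L.coeff i j) t (jet u t) * partialDeriv I v t

/-! ### Surfaces -/

/-- The closed unit square. -/
def unitSquare : Set (ℝ × ℝ) := Icc 0 1

/-- The four edges of the unit square, each parametrized over `[0, 1]`, run through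
counterclockwise. -/
def edge : Fin 4 → ℝ → ℝ × ℝ :=
  ![fun s => (s, 0), fun s => (1, s), fun s => (1 - s, 1), fun s => (0, 1 - s)]

/-- The identification of points of a disjoint union of `m` unit squares given by a gluing
`g` of their edges: an edge `e` with `g e ≠ e` is identified with the edge `g e`,
the directions of the two edges being opposite. -/
def GlueRel {m : ℕ} (g : Fin m × Fin 4 → Fin m × Fin 4) (x y : Fin m × (ℝ × ℝ)) : Prop :=
  ∃ e : Fin m × Fin 4, g e ≠ e ∧ ∃ s ∈ Icc (0 : ℝ) 1,
    x = (e.1, edge e.2 s) ∧ y = ((g e).1, edge (g e).2 (1 - s))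

/-- A compact oriented piecewise smooth embedded surface (possibly with boundary) in multi-time.
An abstract compact oriented surface is obtained from finitely many unit squares by gluing
some of their edges in pairs with opposite directions; it is mapped injectively to multi-time,
and on each closed square the map is a smooth immersion. Compact oriented smooth surfaces are
of this kind (cut them into smooth quadrilaterals), as are the stepped
surfaces, made of finitely many rectangles parallel to coordinate planes. -/
structure Surface (N : ℕ) where
  /-- The number of squares. -/
  numTiles : ℕ
  /-- The parametrizations of the smooth pieces, which also orient them. -/
  tile : Fin numTiles → ℝ × ℝ → MultiTime N
  /-- The gluing of edges; the fixed points of this involution are the free edges. -/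
  glue : Fin numTiles × Fin 4 → Fin numTiles × Fin 4
  smooth : ∀ a, ContDiff ℝ ∞ (tile a)
  immersion : ∀ a, ∀ x ∈ unitSquare, Function.Injective (fderiv ℝ (tile a) x)
  glue_glue : ∀ e, glue (glue e) = e
  compatible : ∀ e, glue e ≠ e → ∀ s ∈ Icc (0 : ℝ) 1,
    tile e.1 (edge e.2 s) = tile (glue e).1 (edge (glue e).2 (1 - s))
  injective : ∀ a b, ∀ x ∈ unitSquare, ∀ y ∈ unitSquare,
    tile a x = tile b y → Relation.EqvGen (GlueRel glue) (a, x) (b, y)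

/-- The boundary `∂S`: the union of the free edges. -/
def Surface.boundary {N : ℕ} (S : Surface N) : Set (MultiTime N) :=
  {q | ∃ e, S.glue e = e ∧ ∃ s ∈ Icc (0 : ℝ) 1, q = S.tile e.1 (edge e.2 s)}

/-- The integral over `S` of the two-form `∑_{i<j} w_{ij} dt_i ∧ dt_j`: the sum over the tiles of
the integrals over the unit square of the pullback. -/
def Surface.integral {N : ℕ} (S : Surface N) (w : Fin N → Fin N → MultiTime N → ℝ) : ℝ :=
  ∑ a, ∫ x in unitSquare, ∑ i, ∑ j ∈ Finset.univ.filter (fun j => i < j),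
    w i j (S.tile a x) *
      (fderiv ℝ (S.tile a) x (1, 0) i * fderiv ℝ (S.tile a) x (0, 1) j
        - fderiv ℝ (S.tile a) x (1, 0) j * fderiv ℝ (S.tile a) x (0, 1) i)

/-! ### The pluri-Lagrangian problem -/

/-- The field `u` is critical for the action `∫_S L`: the variation of the action vanishes for
every smooth variation `v` that vanishes near the boundary of `S`. -/
def LagrangianTwoForm.IsCriticalOn {N n : ℕ} (L : LagrangianTwoForm N n)
    (u : MultiTime N → ℝ) (S : Surface N) : Prop :=
  ∀ v : MultiTime N → ℝ, ContDiff ℝ ∞ v → Disjoint (tsupport v) S.boundary →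
    S.integral (L.variation u v) = 0

/-- The field `u` solves the pluri-Lagrangian problem for `L`: it is critical for the action on
all surfaces simultaneously. -/
def LagrangianTwoForm.SolvesPluriLagrangianProblem {N n : ℕ} (L : LagrangianTwoForm N n)
    (u : MultiTime N → ℝ) : Prop :=
  ∀ S : Surface N, L.IsCriticalOn u S

/-- The function `δ_{ij} L_{ij} / δu_I` on multi-time, evaluated on the field `u`. -/
def LagrangianTwoForm.varDerivOn {N n : ℕ} (L : LagrangianTwoForm N n)
    (u : MultiTime N → ℝ) (i j : Fin N) (I : MultiIndex N) : MultiTime N → ℝ :=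
  fun t => varDeriv i j (L.coeff i j) I t (jet u t)

end PluriLagrangian

end

open PluriLagrangian

noncomputable section

namespace PluriLagrangian

/-! ### Smooth functions on multi-time -/

/-! Along a fixed field `u` the variation of the Lagrangian is a two-form whose coefficients are the
linear differential operators `A i j : v ↦ ∑_I (∂L_{ij}/∂u_I) v_I`. The equations are a
coefficientwise form of exactness of this two-form. An operator is stored as its finitely supported
family of coefficients, like a polynomial in the commuting shifts; composition with `∂_i` is then
`totalDer i`.

The variational derivative in the direction `i` is a terminating Neumann series, and it inverts
`antiVar i`, which is `1 + shiftDown i * derCoeff i`. Hence `A i j = antiVar i (antiVar j (E i j))`,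
where `E` consists of the variational derivatives (`coeffFamily_eq`, `varFamily_apply`). Since
`antiVar i` turns `shiftUp i` into `totalDer i` and commutes with the other total derivatives, these
operators carry the Koszul differential of the shifts, acting on `E`, to the exterior derivative,
acting on `A`. The coefficients of the Koszul relation give the second and third equations; the
first one must be kept separately, because for `N = 2` there are no triples of directions.

Sufficiency: the equations give `E` a Koszul potential (`exists_potential`), so `A` is exact
(`exists_primitive`). The variation is then the exterior derivative of a one-form supported in the
support of `v`, and Stokes' theorem (`Surface.integral_exterior`) makes its integral vanish.

Necessity: on a flat coordinate square, integration by parts removes everything from `A i j` except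
the entries of `E i j` free of `i` and `j`, which gives the first equation. Deforming the square in
a third direction shows that `A` is closed (`closed_of_isCriticalOn`), and injectivity of `antiVar`
turns closedness into the Koszul relation (`koszul_of_closed`). The test functions are exponentials
times cutoffs: exponentials detect every coefficient of an operator at a point. -/

/-- The algebra of smooth functions on multi-time. -/
def smoothFun (N : ℕ) : Subalgebra ℝ (MultiTime N → ℝ) where
  carrier := {f | ContDiff ℝ ∞ f}
  mul_mem' {f g} (hf : ContDiff ℝ ∞ f) (hg : ContDiff ℝ ∞ g) := hf.mul hg
  add_mem' {f g} (hf : ContDiff ℝ ∞ f) (hg : ContDiff ℝ ∞ g) := hf.add hg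
  algebraMap_mem' c := (contDiff_const : ContDiff ℝ ∞ fun _ : MultiTime N => c)

theorem contDiff_coe {N : ℕ} (f : smoothFun N) : ContDiff ℝ ∞ f.1 := f.2

theorem contDiff_partialD {N : ℕ} (i : Fin N) {f : MultiTime N → ℝ} (hf : ContDiff ℝ ∞ f) :
    ContDiff ℝ ∞ (partialD i f) :=
  (hf.fderiv_right (m := ∞) (by simp)).clm_apply contDiff_const

theorem differentiable_coe {N : ℕ} (f : smoothFun N) : Differentiable ℝ f.1 :=
  (contDiff_coe f).differentiable (by simp)

/-- The partial derivative as a linear operator on smooth functions. -/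
def der {N : ℕ} (i : Fin N) : smoothFun N →ₗ[ℝ] smoothFun N where
  toFun f := ⟨partialD i f.1, contDiff_partialD i f.2⟩
  map_add' f g := by
    ext t
    change fderiv ℝ (f.1 + g.1) t _ = fderiv ℝ f.1 t _ + fderiv ℝ g.1 t _
    rw [fderiv_add (differentiable_coe f t) (differentiable_coe g t)]
    rfl
  map_smul' c f := by
    ext t
    change fderiv ℝ (c • f.1) t _ = c • fderiv ℝ f.1 t _
    rw [fderiv_const_smul (differentiable_coe f t)]
    rfl

@[simp]
theorem coe_der {N : ℕ} (i : Fin N) (f : smoothFun N) : (der i f).1 = partialD i f.1 := rfl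

theorem der_mul {N : ℕ} (i : Fin N) (f g : smoothFun N) :
    der i (f * g) = der i f * g + f * der i g := by
  ext t
  change fderiv ℝ (f.1 * g.1) t _ = fderiv ℝ f.1 t _ * g.1 t + f.1 t * fderiv ℝ g.1 t _
  rw [fderiv_mul (differentiable_coe f t) (differentiable_coe g t)]
  simp
  ring

theorem partialD_comm {N : ℕ} (i j : Fin N) {f : MultiTime N → ℝ} (hf : ContDiff ℝ ∞ f) :
    partialD i (partialD j f) = partialD j (partialD i f) := by
  have key : ∀ (a b : MultiTime N) t, fderiv ℝ (fun t => fderiv ℝ f t a) t b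
      = fderiv ℝ (fderiv ℝ f) t b a := by
    intro a b t
    have h := (hf.fderiv_right (m := ∞) (by simp)).differentiable (by simp) t
    rw [fderiv_clm_apply h (differentiableAt_const a)]
    simp
  ext t
  have hs : IsSymmSndFDerivAt ℝ f t :=
    hf.contDiffAt.isSymmSndFDerivAt (by
      rw [minSmoothness_of_isRCLikeNormedField]
      exact WithTop.coe_le_coe.2 le_top)
  exact (key _ _ t).trans ((hs _ _).trans (key _ _ t).symm)

theorem commute_der {N : ℕ} (i j : Fin N) : Commute (der i : Module.End ℝ (smoothFun N)) (der j) :=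
  LinearMap.ext fun f => Subtype.ext (partialD_comm i j f.2)

/-- The operator `v ↦ v_I` on smooth functions. -/
def iterDer {N : ℕ} (I : MultiIndex N) : Module.End ℝ (smoothFun N) :=
  ((List.finRange N).map fun i => (der i : Module.End ℝ (smoothFun N)) ^ I i).prod

theorem coe_der_pow {N : ℕ} (i : Fin N) (a : ℕ) (f : smoothFun N) :
    (((der i : Module.End ℝ (smoothFun N)) ^ a) f).1 = (partialD i)^[a] f.1 := by
  induction a with
  | zero => rfl
  | succ a ih =>
    rw [Function.iterate_succ_apply', pow_succ', ← ih]
    rfl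

@[simp]
theorem coe_iterDer {N : ℕ} (I : MultiIndex N) (f : smoothFun N) :
    (iterDer I f).1 = partialDeriv I f.1 := by
  unfold iterDer partialDeriv
  induction List.finRange N with
  | nil => rfl
  | cons i l ih =>
    rw [List.map_cons, List.prod_cons, List.foldr_cons, ← ih]
    exact coe_der_pow _ _ _

/-- Partial derivatives commute, so the additional factor can be moved to the front of the ordered
product. -/
theorem iterDer_add_single {N : ℕ} (I : MultiIndex N) (i : Fin N) :
    iterDer (I + Pi.single i 1) = der i * iterDer I := by
  unfold iterDer
  have hi : i ∈ List.finRange N := List.mem_finRange i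
  have hn := List.nodup_finRange N
  have hmap : ∀ l : List (Fin N), i ∉ l →
      (l.map fun k => (der k : Module.End ℝ (smoothFun N)) ^ (I + Pi.single i 1 : MultiIndex N) k)
        = l.map fun k => der k ^ I k := by
    intro l hl
    refine List.map_congr_left fun k hk => ?_
    have : k ≠ i := fun h => hl (h ▸ hk)
    simp [this]
  generalize List.finRange N = L at hi hn
  induction L with
  | nil => simp at hi
  | cons k l ih =>
    rw [List.map_cons, List.prod_cons, List.map_cons, List.prod_cons]
    rw [List.nodup_cons] at hn
    by_cases hk : k = i
    · subst hk
      rw [hmap l hn.1, Pi.add_apply, Pi.single_eq_same, pow_succ', mul_assoc]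
    · have hi' : i ∈ l := by
        rcases List.mem_cons.1 hi with h | h
        · exact absurd h.symm hk
        · exact h
      rw [ih hi' hn.2, Pi.add_apply, Pi.single_eq_of_ne hk, add_zero, ← mul_assoc, ← mul_assoc,
        ((commute_der k i).pow_left (I k)).eq]

theorem partialD_partialDeriv {N : ℕ} (I : MultiIndex N) (i : Fin N) {u : MultiTime N → ℝ}
    (hu : ContDiff ℝ ∞ u) :
    partialD i (partialDeriv I u) = partialDeriv (I + Pi.single i 1) u := by
  have h := congr_arg (fun F : Module.End ℝ (smoothFun N) => (F ⟨u, hu⟩).1)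
    (iterDer_add_single I i)
  simpa using h.symm

theorem contDiff_partialDeriv {N : ℕ} (I : MultiIndex N) {u : MultiTime N → ℝ}
    (hu : ContDiff ℝ ∞ u) : ContDiff ℝ ∞ (partialDeriv I u) := by
  simpa using contDiff_coe (iterDer I ⟨u, hu⟩)

/-! ### Functions on jet space along a field -/

/-- Restriction of a function on jet space to the jet of the field `u`. -/
def onJet {N : ℕ} (u : MultiTime N → ℝ) (F : MultiTime N → JetFiber N → ℝ) : MultiTime N → ℝ :=
  fun t => F t (jet u t)

theorem sum_add_single {N : ℕ} (I : MultiIndex N) (i : Fin N) (a : ℕ) :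
    ∑ k, (I + Pi.single i a : MultiIndex N) k = ∑ k, I k + a := by
  simp [Finset.sum_add_distrib]

theorem contDiff_onJet {N n : ℕ} {F : MultiTime N → JetFiber N → ℝ} (hF : IsSmoothJetFunction n F)
    {u : MultiTime N → ℝ} (hu : ContDiff ℝ ∞ u) : ContDiff ℝ ∞ (onJet u F) := by
  obtain ⟨G, hG, h⟩ := hF
  have : onJet u F = fun t => G (t, fun I => partialDeriv I u t) := funext fun t => h t _
  rw [this]
  exact hG.comp (contDiff_id.prodMk (contDiff_pi.2 fun I => contDiff_partialDeriv I.1 hu))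

theorem jetPartial_eq_zero {N n : ℕ} {F : MultiTime N → JetFiber N → ℝ}
    (hF : IsSmoothJetFunction n F) {I : MultiIndex N} (hI : n < ∑ k, I k) :
    jetPartial I F = 0 := by
  obtain ⟨G, -, h⟩ := hF
  ext t p
  have : (fun s : ℝ => F t (Function.update p I s)) = fun _ => F t p := by
    funext s
    rw [h, h]
    congr 2
    funext J
    refine Function.update_of_ne (fun hJ => ?_) _ _
    have := mem_jetIndices.1 J.2
    rw [hJ] at this
    omega
  simp only [jetPartial, this, deriv_const]
  rfl

theorem jetPartial_eq_fderiv {N n : ℕ} {F : MultiTime N → JetFiber N → ℝ}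
    {G : MultiTime N × (jetIndices N n → ℝ) → ℝ} (hG : ContDiff ℝ ∞ G)
    (h : ∀ t p, F t p = G (t, fun I => p I)) (I : jetIndices N n) (t : MultiTime N)
    (p : JetFiber N) :
    jetPartial I.1 F t p = fderiv ℝ G (t, fun I => p I) (0, Pi.single I 1) := by
  have hfun : (fun s : ℝ => F t (Function.update p I.1 s))
      = fun s => G (t, Function.update (fun J : jetIndices N n => p J) I s) := by
    funext s
    rw [h]
    congr 2
    funext J
    by_cases hJ : J = I
    · subst hJ; simp
    · rw [Function.update_of_ne hJ, Function.update_of_ne fun h => hJ (Subtype.ext h)]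
  have hd : HasDerivAt (fun s : ℝ => ((t, Function.update (fun J : jetIndices N n => p J) I s) :
      MultiTime N × (jetIndices N n → ℝ))) (0, Pi.single I 1) (p I) :=
    (hasDerivAt_const _ _).prodMk (hasDerivAt_update _ _ _)
  have hG' : HasFDerivAt G (fderiv ℝ G (t, fun I => p I))
      (t, Function.update (fun J : jetIndices N n => p J) I (p I)) := by
    rw [Function.update_eq_self]
    exact (hG.differentiable (by simp) _).hasFDerivAt
  rw [jetPartial, hfun]
  exact (hG'.comp_hasDerivAt (p I) hd).deriv

theorem IsSmoothJetFunction.jetPartial {N n : ℕ} {F : MultiTime N → JetFiber N → ℝ}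
    (hF : IsSmoothJetFunction n F) (I : MultiIndex N) :
    IsSmoothJetFunction n (PluriLagrangian.jetPartial I F) := by
  by_cases hI : I ∈ jetIndices N n
  · obtain ⟨G, hG, h⟩ := hF
    exact ⟨fun x => fderiv ℝ G x (0, Pi.single ⟨I, hI⟩ 1),
      (hG.fderiv_right (m := ∞) (by simp)).clm_apply contDiff_const,
      fun t p => jetPartial_eq_fderiv hG h ⟨I, hI⟩ t p⟩
  · rw [mem_jetIndices, not_le] at hI
    rw [jetPartial_eq_zero hF hI]
    exact ⟨0, contDiff_const, fun _ _ => rfl⟩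

/-- In finitely many jet coordinates the total derivative is a single directional derivative of `G`.
This gives both its smoothness and, by the chain rule, its meaning along a field. -/
theorem totalD_eq {N n : ℕ} {F : MultiTime N → JetFiber N → ℝ}
    {G : MultiTime N × (jetIndices N n → ℝ) → ℝ} (hG : ContDiff ℝ ∞ G)
    (h : ∀ t p, F t p = G (t, fun I => p I)) (i : Fin N) (t : MultiTime N) (p : JetFiber N) :
    totalD i F t p = fderiv ℝ G (t, fun I => p I)
      (Pi.single i 1, fun I => p (I.1 + Pi.single i 1)) := by
  have h1 : fderiv ℝ (fun t' => F t' p) t (Pi.single i 1)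
      = fderiv ℝ G (t, fun I => p I) (Pi.single i 1, 0) := by
    have hd : HasFDerivAt (fun t' : MultiTime N => ((t', fun I => p I) :
        MultiTime N × (jetIndices N n → ℝ))) ((ContinuousLinearMap.id ℝ _).prod 0) t :=
      (hasFDerivAt_id t).prodMk (hasFDerivAt_const _ _)
    have hG' : HasFDerivAt G (fderiv ℝ G (t, fun I => p I)) (t, fun I => p I) :=
      (hG.differentiable (by simp) _).hasFDerivAt
    have hF : (fun t' => F t' p) = G ∘ fun t' => (t', fun I => p I) := funext fun t' => h t' p
    rw [hF, (hG'.comp t hd).fderiv]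
    simp
  have h2 : (∑ᶠ I : MultiIndex N, p (I + Pi.single i 1) * jetPartial I F t p)
      = ∑ I : jetIndices N n, p (I.1 + Pi.single i 1) *
        fderiv ℝ G (t, fun I => p I) (0, Pi.single I 1) := by
    rw [finsum_eq_sum_of_support_subset (s := jetIndices N n), ← Finset.sum_coe_sort]
    · exact Finset.sum_congr rfl fun I _ => by rw [jetPartial_eq_fderiv hG h]
    · intro I hI
      by_contra hn
      rw [Finset.mem_coe, mem_jetIndices, not_le] at hn
      exact hI (by simp [jetPartial_eq_zero ⟨G, hG, h⟩ hn])
  rw [totalD, h1, h2]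
  -- The direction is split along the coordinate axes, so that linearity recovers the terms of the
  -- defining sum.
  have h3 : ((Pi.single i 1, fun I => p (I.1 + Pi.single i 1)) :
      MultiTime N × (jetIndices N n → ℝ)) = (Pi.single i 1, 0)
        + ∑ I : jetIndices N n, p (I.1 + Pi.single i 1) • (0, Pi.single I 1) := by
    refine Prod.ext ?_ ?_
    · simp [Prod.fst_sum]
    · funext J
      simp [Prod.snd_sum, Finset.sum_apply, Pi.single_apply]
  rw [h3, map_add, map_sum]
  simp only [map_smul, smul_eq_mul]

theorem IsSmoothJetFunction.totalD {N n : ℕ} {F : MultiTime N → JetFiber N → ℝ}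
    (hF : IsSmoothJetFunction n F) (i : Fin N) :
    IsSmoothJetFunction (n + 1) (PluriLagrangian.totalD i F) := by
  obtain ⟨G, hG, h⟩ := hF
  have hm : ∀ I : jetIndices N n, I.1 ∈ jetIndices N (n + 1) := fun I =>
    mem_jetIndices.2 ((mem_jetIndices.1 I.2).trans (Nat.le_succ n))
  have hm' : ∀ I : jetIndices N n, I.1 + Pi.single i 1 ∈ jetIndices N (n + 1) := fun I => by
    rw [mem_jetIndices, sum_add_single]
    exact Nat.succ_le_succ (mem_jetIndices.1 I.2)
  refine ⟨fun x => fderiv ℝ G (x.1, fun I => x.2 ⟨I, hm I⟩)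
    (Pi.single i 1, fun I => x.2 ⟨_, hm' I⟩), ?_, fun t p => totalD_eq hG h i t p⟩
  have hc : ∀ f : jetIndices N n → jetIndices N (n + 1),
      ContDiff ℝ ∞ fun x : MultiTime N × (jetIndices N (n + 1) → ℝ) => fun I => x.2 (f I) :=
    fun f => contDiff_pi.2 fun I => (contDiff_apply ℝ ℝ (f I)).comp contDiff_snd
  exact ((hG.fderiv_right (m := ∞) (by simp)).comp
    (contDiff_fst.prodMk (hc fun I => ⟨I, hm I⟩))).clm_apply
    (contDiff_const.prodMk (hc fun I => ⟨_, hm' I⟩))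

theorem onJet_totalD {N n : ℕ} {F : MultiTime N → JetFiber N → ℝ} (hF : IsSmoothJetFunction n F)
    (i : Fin N) {u : MultiTime N → ℝ} (hu : ContDiff ℝ ∞ u) :
    onJet u (totalD i F) = partialD i (onJet u F) := by
  obtain ⟨G, hG, h⟩ := hF
  ext t
  have hfun : onJet u F = G ∘ fun t => (t, fun I => partialDeriv I u t) := funext fun t => h t _
  have hG' : HasFDerivAt G (fderiv ℝ G (t, fun I => partialDeriv I u t))
      (t, fun I => partialDeriv I u t) := (hG.differentiable (by simp) _).hasFDerivAt
  have hd : HasFDerivAt (fun t => ((t, fun I => partialDeriv I u t) :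
      MultiTime N × (jetIndices N n → ℝ))) ((ContinuousLinearMap.id ℝ _).prod
        (ContinuousLinearMap.pi fun I => fderiv ℝ (partialDeriv I.1 u) t)) t :=
    (hasFDerivAt_id t).prodMk (hasFDerivAt_pi.2 fun I =>
      ((contDiff_partialDeriv I.1 hu).differentiable (by simp) t).hasFDerivAt)
  rw [partialD, hfun, (hG'.comp t hd).fderiv, onJet, totalD_eq hG h]
  simp only [jet, ← partialD_partialDeriv _ i hu]
  rfl

theorem onJet_iterate_totalD (i : Fin N) {u : MultiTime N → ℝ} (hu : ContDiff ℝ ∞ u) (a : ℕ)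
    {n : ℕ} {F : MultiTime N → JetFiber N → ℝ} (hF : IsSmoothJetFunction n F) :
    IsSmoothJetFunction (n + a) ((totalD i)^[a] F) ∧
      onJet u ((totalD i)^[a] F) = (partialD i)^[a] (onJet u F) := by
  induction a with
  | zero => exact ⟨hF, rfl⟩
  | succ a ih =>
    rw [Function.iterate_succ_apply', Function.iterate_succ_apply', ← ih.2]
    exact ⟨ih.1.totalD i, onJet_totalD ih.1 i hu⟩

/-! ### Families of smooth functions indexed by multi-indices -/

/-- Finitely supported families `(f_I)` of smooth functions, which stand for the linear
differential operators `v ↦ ∑_I f_I v_I`. -/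
abbrev Family (N : ℕ) : Type := MultiIndex N →₀ smoothFun N

variable {N : ℕ}

instance : AddCommGroup (smoothFun N) := inferInstance

instance : AddCommGroup (Family N) := Finsupp.instAddCommGroup

theorem add_single_injective (i : Fin N) :
    Function.Injective fun I : MultiIndex N => I + Pi.single i 1 :=
  fun _ _ h => add_right_cancel h

theorem exists_eq_add_single {J : MultiIndex N} {i : Fin N} (h : J i ≠ 0) :
    ∃ I : MultiIndex N, J = I + Pi.single i 1 := by
  refine ⟨J - Pi.single i 1, (tsub_add_cancel_of_le fun k => ?_).symm⟩
  by_cases hk : k = i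
  · subst hk
    simpa using Nat.one_le_iff_ne_zero.2 h
  · simp [hk]

theorem add_single_apply_of_ne (I : MultiIndex N) {i k : Fin N} (h : k ≠ i) :
    (I + Pi.single i 1 : MultiIndex N) k = I k := by
  simp [h]

/-- The operator `(f_I) ↦ (∂_i f_I)`. -/
def derCoeff (i : Fin N) : Module.End ℝ (Family N) := Finsupp.mapRange.linearMap (der i)

/-- The shift `(f_I) ↦ (f_{I i})`. -/
def shiftDown (i : Fin N) : Module.End ℝ (Family N) :=
  Finsupp.lcomapDomain (fun I => I + Pi.single i 1) (add_single_injective i)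

/-- The shift which moves `f_I` to the multi-index `I i`. -/
def shiftUp (i : Fin N) : Module.End ℝ (Family N) :=
  Finsupp.lmapDomain (smoothFun N) ℝ fun I => I + Pi.single i 1

@[simp]
theorem shiftDown_apply (i : Fin N) (f : Family N) (I : MultiIndex N) :
    shiftDown i f I = f (I + Pi.single i 1) := rfl

@[simp]
theorem shiftUp_apply_add (i : Fin N) (f : Family N) (I : MultiIndex N) :
    shiftUp i f (I + Pi.single i 1) = f I :=
  Finsupp.mapDomain_apply (add_single_injective i) f I

theorem shiftUp_apply_zero (i : Fin N) (f : Family N) {J : MultiIndex N} (h : J i = 0) :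
    shiftUp i f J = 0 := by
  refine Finsupp.mapDomain_of_notMem_range f J ?_
  rintro ⟨I, rfl⟩
  simp at h

@[simp]
theorem shiftUp_single (i : Fin N) (I : MultiIndex N) (g : smoothFun N) :
    shiftUp i (Finsupp.single I g) = Finsupp.single (I + Pi.single i 1) g :=
  Finsupp.mapDomain_single

@[simp]
theorem derCoeff_single (i : Fin N) (I : MultiIndex N) (g : smoothFun N) :
    derCoeff i (Finsupp.single I g) = Finsupp.single I (der i g) :=
  Finsupp.mapRange_single (hf := map_zero _)

theorem shiftDown_mul_shiftUp (i : Fin N) : shiftDown i * shiftUp i = (1 : Module.End ℝ (Family N)) :=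
  LinearMap.ext fun f => Finsupp.ext fun I => shiftUp_apply_add i f I

theorem commute_shiftDown_shiftUp {i j : Fin N} (h : i ≠ j) :
    Commute (shiftDown i : Module.End ℝ (Family N)) (shiftUp j) := by
  refine LinearMap.ext fun f => Finsupp.ext fun J => ?_
  change shiftUp j f (J + Pi.single i 1) = shiftUp j (shiftDown i f) J
  by_cases hJ : J j = 0
  · rw [shiftUp_apply_zero _ _ hJ, shiftUp_apply_zero]
    rwa [add_single_apply_of_ne _ h.symm]
  · obtain ⟨I, rfl⟩ := exists_eq_add_single hJ
    rw [add_right_comm, shiftUp_apply_add, shiftUp_apply_add, shiftDown_apply]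

theorem commute_shiftDown (i j : Fin N) :
    Commute (shiftDown i : Module.End ℝ (Family N)) (shiftDown j) :=
  LinearMap.ext fun f => Finsupp.ext fun J => congr_arg f (add_right_comm J _ _)

theorem commute_derCoeff (i j : Fin N) :
    Commute (derCoeff i : Module.End ℝ (Family N)) (derCoeff j) :=
  LinearMap.ext fun f => Finsupp.ext fun J => LinearMap.congr_fun (commute_der i j) (f J)

theorem commute_derCoeff_shiftDown (i j : Fin N) :
    Commute (derCoeff i : Module.End ℝ (Family N)) (shiftDown j) :=
  LinearMap.ext fun _ => Finsupp.ext fun _ => rfl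

theorem commute_derCoeff_shiftUp (i j : Fin N) :
    Commute (derCoeff i : Module.End ℝ (Family N)) (shiftUp j) := by
  refine Finsupp.lhom_ext fun I g => ?_
  simp

/-! ### Total derivatives and the inverse of the variational derivative -/

/-- The operator on families that corresponds to the composition of `∂_i` with a differential
operator. -/
def totalDer (i : Fin N) : Module.End ℝ (Family N) := derCoeff i + shiftUp i

/-- The operator `(f_I) ↦ (f_I + ∂_i f_{I i})`, which undoes the variational derivative in the
direction `i`. -/
def antiVar (i : Fin N) : Module.End ℝ (Family N) := 1 + shiftDown i * derCoeff i

/-- Expand and use that shifting up and then down is the identity. This is the identity that links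
the Koszul differential with the exterior derivative. -/
theorem antiVar_mul_shiftUp (i : Fin N) : antiVar i * shiftUp i = totalDer i := by
  rw [antiVar, totalDer, add_mul, one_mul, mul_assoc, (commute_derCoeff_shiftUp i i).eq,
    ← mul_assoc, shiftDown_mul_shiftUp, one_mul, add_comm]

/-- One integration by parts: `1 - shiftUp i * shiftDown i` projects to the entries with `I i = 0`,
and the rest is a total derivative. -/
theorem antiVar_eq (i : Fin N) :
    antiVar i = totalDer i * shiftDown i + (1 - shiftUp i * shiftDown i) := by
  rw [antiVar, totalDer, add_mul, (commute_derCoeff_shiftDown i i).eq]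
  abel

theorem commute_step (i j : Fin N) : Commute (shiftDown i * derCoeff i : Module.End ℝ (Family N))
    (shiftDown j * derCoeff j) :=
  ((commute_shiftDown i j).mul_right (commute_derCoeff_shiftDown j i).symm).mul_left
    ((commute_derCoeff_shiftDown i j).mul_right (commute_derCoeff i j))

theorem commute_antiVar (i j : Fin N) :
    Commute (antiVar i : Module.End ℝ (Family N)) (antiVar j) :=
  (Commute.one_left _).add_left ((Commute.one_right _).add_right (commute_step i j))

/-- Distinct directions are essential: shifting up and then down in the same direction is the
identity, while the other order loses the entries with `I i = 0`. -/
theorem commute_totalDer_antiVar {i j : Fin N} (h : i ≠ j) :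
    Commute (totalDer i : Module.End ℝ (Family N)) (antiVar j) :=
  (Commute.one_right _).add_right
    (((commute_derCoeff_shiftDown i j).mul_right (commute_derCoeff i j)).add_left
      ((commute_shiftDown_shiftUp h.symm).symm.mul_right (commute_derCoeff_shiftUp j i).symm))

/-- The variational derivative in the direction `i` of families supported in orders below `m`:
`(f_I) ↦ (∑_{a < m} (-1)^a ∂_i^a f_{I i^a})`. -/
def varOp (i : Fin N) (m : ℕ) : Module.End ℝ (Family N) :=
  ∑ a ∈ Finset.range m, (-(shiftDown i * derCoeff i)) ^ a

theorem commute_antiVar_varOp (i j : Fin N) (m : ℕ) :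
    Commute (antiVar i : Module.End ℝ (Family N)) (varOp j m) :=
  Commute.sum_right _ _ _ fun a _ =>
    ((Commute.one_left _).add_left (commute_step i j).neg_right).pow_right a

theorem antiVar_varOp_comm (i j : Fin N) (m : ℕ) (f : Family N) :
    antiVar i (varOp j m f) = varOp j m (antiVar i f) :=
  LinearMap.congr_fun (commute_antiVar_varOp i j m).eq f

theorem commute_varOp (i j : Fin N) (m : ℕ) :
    Commute (varOp i m : Module.End ℝ (Family N)) (varOp j m) :=
  Commute.sum_right _ _ _ fun b _ => Commute.sum_left _ _ _ fun a _ =>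
    (((commute_step i j).neg_right).neg_left.pow_left a).pow_right b

theorem step_pow_apply (i : Fin N) (a : ℕ) (f : Family N) (I : MultiIndex N) :
    ((-(shiftDown i * derCoeff i)) ^ a) f I
      = (-1 : ℝ) ^ a • (((der i : Module.End ℝ (smoothFun N)) ^ a) (f (I + Pi.single i a))) := by
  induction a generalizing I with
  | zero => simp
  | succ a ih =>
    rw [pow_succ']
    change -(der i (((-(shiftDown i * derCoeff i)) ^ a) f (I + Pi.single i 1))) = _
    rw [ih, map_smul, pow_succ' (der i), add_assoc, ← Pi.single_add, add_comm 1 a, pow_succ,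
      mul_neg_one, neg_smul]
    rfl

/-- Families which vanish at all multi-indices of order at least `m`. -/
def OrderLT (m : ℕ) (f : Family N) : Prop := ∀ I : MultiIndex N, m ≤ ∑ k, I k → f I = 0

theorem step_pow_eq_zero (i : Fin N) {m : ℕ} {f : Family N} (hf : OrderLT m f) :
    ((-(shiftDown i * derCoeff i)) ^ m) f = 0 := by
  refine Finsupp.ext fun I => ?_
  rw [step_pow_apply, hf, map_zero, smul_zero]
  · rfl
  · rw [sum_add_single]
    omega

/-- Telescoping of the geometric series: the remaining power lowers orders by `m` and kills `f`. -/
theorem antiVar_varOp (i : Fin N) {m : ℕ} {f : Family N} (hf : OrderLT m f) :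
    antiVar i (varOp i m f) = f := by
  have h := mul_neg_geom_sum (-(shiftDown i * derCoeff i) : Module.End ℝ (Family N)) m
  rw [sub_neg_eq_add] at h
  have h' := LinearMap.congr_fun h f
  rw [LinearMap.sub_apply, step_pow_eq_zero i hf, sub_zero] at h'
  exact h'

theorem exists_orderLT (f : Family N) : ∃ m, OrderLT m f := by
  obtain ⟨m, hm⟩ := (f.support.image fun I => ∑ k, I k).exists_nat_subset_range
  refine ⟨m, fun I hI => ?_⟩
  by_contra h
  have := Finset.mem_range.1 (hm (Finset.mem_image_of_mem _ (Finsupp.mem_support_iff.2 h)))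
  omega

theorem antiVar_injective (i : Fin N) : Function.Injective (antiVar i : Family N → Family N) := by
  refine (injective_iff_map_eq_zero (antiVar i)).2 fun f hf => ?_
  obtain ⟨m, hm⟩ := exists_orderLT f
  -- As the two operators commute, the right inverse on families of order below `m` is also a left
  -- inverse.
  rw [← antiVar_varOp i hm]
  rw [antiVar_varOp_comm, hf, map_zero]

/-! ### Differential operators given by families -/

/-- The function `∑_I f_I v_I`. -/
def pair (v : smoothFun N) : Family N →ₗ[ℝ] smoothFun N :=
  Finsupp.lsum ℝ fun I => LinearMap.mulRight ℝ (iterDer I v)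

@[simp]
theorem pair_single (v : smoothFun N) (I : MultiIndex N) (g : smoothFun N) :
    pair v (Finsupp.single I g) = g * iterDer I v := by
  simp [pair]

/-- Leibniz rule: `derCoeff` differentiates the coefficient and `shiftUp` the argument. -/
theorem der_pair (i : Fin N) (v : smoothFun N) (f : Family N) :
    der i (pair v f) = pair v (totalDer i f) := by
  refine LinearMap.congr_fun (f := der i ∘ₗ pair v) (g := pair v ∘ₗ totalDer i) ?_ f
  refine Finsupp.lhom_ext fun I g => ?_
  simp [totalDer, der_mul, iterDer_add_single]

theorem pair_apply (v : smoothFun N) (f : Family N) (t : MultiTime N) :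
    (pair v f).1 t = ∑ I ∈ f.support, (f I).1 t * partialDeriv I v.1 t := by
  have : pair v f = ∑ I ∈ f.support, f I * iterDer I v := rfl
  rw [this, AddSubmonoidClass.coe_finsetSum, Finset.sum_apply]
  refine Finset.sum_congr rfl fun I _ => ?_
  rw [← coe_iterDer]
  rfl

theorem partialDeriv_congr {v w : MultiTime N → ℝ} {t : MultiTime N} (h : v =ᶠ[nhds t] w)
    (I : MultiIndex N) : partialDeriv I v =ᶠ[nhds t] partialDeriv I w := by
  have h1 : ∀ (i : Fin N) {f g : MultiTime N → ℝ}, f =ᶠ[nhds t] g →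
      partialD i f =ᶠ[nhds t] partialD i g := fun i f g hfg => by
    filter_upwards [hfg.fderiv (𝕜 := ℝ)] with s hs
    rw [partialD, partialD, hs]
  have h2 : ∀ (i : Fin N) (a : ℕ) {f g : MultiTime N → ℝ}, f =ᶠ[nhds t] g →
      (partialD i)^[a] f =ᶠ[nhds t] (partialD i)^[a] g := fun i a f g hfg => by
    induction a with
    | zero => exact hfg
    | succ a ih =>
      rw [Function.iterate_succ_apply', Function.iterate_succ_apply']
      exact h1 i ih
  unfold partialDeriv
  induction List.finRange N with
  | nil => exact h
  | cons i l ih => exact h2 i (I i) ih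

theorem pair_congr {v w : smoothFun N} {t : MultiTime N} (h : v.1 =ᶠ[nhds t] w.1) (f : Family N) :
    (pair v f).1 t = (pair w f).1 t := by
  simp only [pair_apply, (partialDeriv_congr h _).eq_of_nhds]

theorem pair_eq_zero_of_notMem {v : smoothFun N} {t : MultiTime N} (h : t ∉ tsupport v.1)
    (f : Family N) : (pair v f).1 t = 0 := by
  rw [pair_congr (w := 0) (notMem_tsupport_iff_eventuallyEq.1 h)]
  have h0 : pair (0 : smoothFun N) f = 0 := by
    have : pair (0 : smoothFun N) f = ∑ I ∈ f.support, f I * iterDer I 0 := rfl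
    simp [this]
  rw [h0]
  rfl

/-! ### The Koszul relation -/

/-- The multi-time Euler–Lagrange equations for a family of operators `E i j`. -/
def EulerLagrange (E : Fin N → Fin N → Family N) : Prop :=
  (∀ i j : Fin N, i ≠ j → ∀ I : MultiIndex N, I i = 0 → I j = 0 → E i j I = 0) ∧
  (∀ i j k : Fin N, i ≠ j → j ≠ k → i ≠ k → ∀ I : MultiIndex N, I i = 0 →
    E i j (I + Pi.single j 1) = E i k (I + Pi.single k 1)) ∧
  (∀ i j k : Fin N, i ≠ j → j ≠ k → i ≠ k → ∀ I : MultiIndex N,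
    E i j (I + Pi.single i 1 + Pi.single j 1) + E j k (I + Pi.single j 1 + Pi.single k 1)
      + E k i (I + Pi.single k 1 + Pi.single i 1) = 0)

/-- Compare entries at `J`. A term survives only if `J` contains its shift direction, so the number
of zeros among `J i`, `J j`, `J k` decides which equation applies: the third for none, the second
for one, the first for two; for three zeros the relation is trivial. -/
theorem koszul_of_eulerLagrange {E : Fin N → Fin N → Family N} (hE : ∀ i j, E j i = -E i j)
    (h : EulerLagrange E) {i j k : Fin N} (hij : i ≠ j) (hjk : j ≠ k) (hik : i ≠ k) :
    shiftUp i (E j k) + shiftUp j (E k i) + shiftUp k (E i j) = 0 := by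
  obtain ⟨h1, h2, h3⟩ := h
  have one : ∀ {i j k : Fin N}, i ≠ j → j ≠ k → i ≠ k → ∀ {J : MultiIndex N}, J i = 0 → J j = 0 →
      shiftUp k (E i j) J = 0 := by
    intro i j k hij hjk hik J hi hj
    by_cases hk : J k = 0
    · exact shiftUp_apply_zero _ _ hk
    · obtain ⟨I, rfl⟩ := exists_eq_add_single hk
      rw [add_single_apply_of_ne _ hik] at hi
      rw [add_single_apply_of_ne _ hjk] at hj
      rw [shiftUp_apply_add, h1 i j hij I hi hj]
  have two : ∀ {i j k : Fin N}, i ≠ j → j ≠ k → i ≠ k → ∀ {J : MultiIndex N}, J i = 0 →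
      shiftUp j (E k i) J + shiftUp k (E i j) J = 0 := by
    intro i j k hij hjk hik J hi
    by_cases hj : J j = 0
    · rw [shiftUp_apply_zero _ _ hj, one hij hjk hik hi hj, add_zero]
    by_cases hk : J k = 0
    · rw [shiftUp_apply_zero _ _ hk, one hik.symm hij hjk.symm hk hi, add_zero]
    obtain ⟨I, rfl⟩ := exists_eq_add_single hj
    rw [add_single_apply_of_ne _ hjk.symm] at hk
    obtain ⟨I, rfl⟩ := exists_eq_add_single hk
    rw [add_single_apply_of_ne _ hij, add_single_apply_of_ne _ hik] at hi
    rw [shiftUp_apply_add, add_right_comm, shiftUp_apply_add, h2 i j k hij hjk hik I hi, hE i k]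
    simp
  refine Finsupp.ext fun J => ?_
  rw [Finsupp.add_apply, Finsupp.add_apply, Finsupp.zero_apply]
  by_cases hi : J i = 0
  · rw [shiftUp_apply_zero _ _ hi, zero_add, two hij hjk hik hi]
  by_cases hj : J j = 0
  · rw [shiftUp_apply_zero _ _ hj, add_zero, add_comm, two hjk hik.symm hij.symm hj]
  by_cases hk : J k = 0
  · rw [shiftUp_apply_zero _ _ hk, add_zero, two hik.symm hij hjk.symm hk]
  obtain ⟨I, rfl⟩ := exists_eq_add_single hi
  rw [add_single_apply_of_ne _ hij.symm] at hj
  obtain ⟨I, rfl⟩ := exists_eq_add_single hj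
  rw [add_single_apply_of_ne _ hik.symm, add_single_apply_of_ne _ hjk.symm] at hk
  obtain ⟨I, rfl⟩ := exists_eq_add_single hk
  have e1 : I + Pi.single k 1 + Pi.single j 1 + Pi.single i 1
      = I + Pi.single k 1 + Pi.single i 1 + Pi.single j 1 := add_right_comm _ _ _
  have e2 : I + Pi.single k 1 + Pi.single j 1 + Pi.single i 1
      = I + Pi.single i 1 + Pi.single j 1 + Pi.single k 1 := by abel
  have e3 : I + Pi.single j 1 + Pi.single k 1 = I + Pi.single k 1 + Pi.single j 1 :=
    add_right_comm _ _ _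
  rw [shiftUp_apply_add, e1, shiftUp_apply_add, ← e1, e2, shiftUp_apply_add,
    ← h3 i j k hij hjk hik I, e3]
  abel

/-- The second equation is the entry at `I j k`, where the term shifted in the direction `i` drops
out; the third is the entry at `I i j k`. -/
theorem eulerLagrange_of_koszul {E : Fin N → Fin N → Family N} (hE : ∀ i j, E j i = -E i j)
    (h1 : ∀ i j : Fin N, i ≠ j → ∀ I : MultiIndex N, I i = 0 → I j = 0 → E i j I = 0)
    (h : ∀ i j k : Fin N, i ≠ j → j ≠ k → i ≠ k →
      shiftUp i (E j k) + shiftUp j (E k i) + shiftUp k (E i j) = 0) : EulerLagrange E := by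
  refine ⟨h1, fun i j k hij hjk hik I hi => ?_, fun i j k hij hjk hik I => ?_⟩
  · have := DFunLike.congr_fun (h i j k hij hjk hik) (I + Pi.single j 1 + Pi.single k 1)
    rw [Finsupp.add_apply, Finsupp.add_apply, Finsupp.zero_apply, shiftUp_apply_add,
      add_right_comm I, shiftUp_apply_add, shiftUp_apply_zero, hE i k, zero_add] at this
    · rw [← sub_eq_zero, ← this, Finsupp.neg_apply]
      abel
    · rw [add_single_apply_of_ne _ hij, add_single_apply_of_ne _ hik, hi]
  · have := DFunLike.congr_fun (h i j k hij hjk hik)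
      (I + Pi.single i 1 + Pi.single j 1 + Pi.single k 1)
    have e1 : I + Pi.single i 1 + Pi.single j 1 + Pi.single k 1
      = I + Pi.single j 1 + Pi.single k 1 + Pi.single i 1 := by abel
    have e2 : I + Pi.single i 1 + Pi.single j 1 + Pi.single k 1
      = I + Pi.single k 1 + Pi.single i 1 + Pi.single j 1 := by abel
    rw [Finsupp.add_apply, Finsupp.add_apply, Finsupp.zero_apply, shiftUp_apply_add, e1,
      shiftUp_apply_add, ← e1, e2, shiftUp_apply_add] at this
    rw [← this]
    abel

theorem shiftUp_shiftDown_apply (i : Fin N) (f : Family N) (J : MultiIndex N) :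
    shiftUp i (shiftDown i f) J = if J i = 0 then 0 else f J := by
  split_ifs with h
  · exact shiftUp_apply_zero _ _ h
  · obtain ⟨I, rfl⟩ := exists_eq_add_single h
    rw [shiftUp_apply_add, shiftDown_apply]

/-! ### Exact and closed two-forms of operators -/

/-- Exactness of the Koszul complex of the shifts in the second degree. -/
theorem exists_potential {E : Fin N → Fin N → Family N} (hE : ∀ i j, E j i = -E i j)
    (h : EulerLagrange E) {p q : Fin N} (hpq : p ≠ q) :
    ∃ H : Fin N → Family N, ∀ i j, i ≠ j → E i j = shiftUp i (H j) - shiftUp j (H i) := by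
  -- Contracting with `p` dictates `H j` for `j ≠ p`. The remaining component must account for the
  -- entries of `E p j` free of `p`; by the second equation any one auxiliary direction `q`
  -- determines it.
  let H : Fin N → Family N := fun j =>
    if j = p then (1 - shiftUp p * shiftDown p : Module.End ℝ (Family N)) (shiftDown q (E q p))
    else shiftDown p (E p j)
  have hp : ∀ j, p ≠ j → E p j = shiftUp p (H j) - shiftUp j (H p) := by
    intro j hj
    have hH : H j = shiftDown p (E p j) := if_neg hj.symm
    have hHp : H p = (1 - shiftUp p * shiftDown p : Module.End ℝ (Family N))
      (shiftDown q (E q p)) := if_pos rfl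
    have hHp' : ∀ J, H p J = if J p = 0 then E q p (J + Pi.single q 1) else 0 := by
      intro J
      rw [hHp]
      change shiftDown q (E q p) J - shiftUp p (shiftDown p (shiftDown q (E q p))) J = _
      rw [shiftUp_shiftDown_apply]
      split_ifs <;> simp
    refine Finsupp.ext fun J => ?_
    rw [Finsupp.sub_apply, hH, shiftUp_shiftDown_apply]
    by_cases hJ : J j = 0
    · rw [shiftUp_apply_zero _ _ hJ, sub_zero]
      split_ifs with h0
      · exact h.1 p j hj J h0 hJ
      · rfl
    · obtain ⟨I, rfl⟩ := exists_eq_add_single hJ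
      rw [shiftUp_apply_add, hHp', add_single_apply_of_ne _ hj]
      split_ifs with h0
      · rw [zero_sub, hE p q, Finsupp.neg_apply, neg_neg]
        by_cases hjq : j = q
        · rw [hjq]
        · exact h.2.1 p j q hj hjq hpq I h0
      · rw [sub_zero]
  refine ⟨H, fun i j hij => ?_⟩
  by_cases hi : i = p
  · subst hi
    exact hp j hij
  by_cases hj : j = p
  · subst hj
    rw [hE j i, hp i hij.symm, neg_sub]
  have hHi : H i = shiftDown p (E p i) := if_neg hi
  have hHj : H j = shiftDown p (E p j) := if_neg hj
  -- Shifting down in the direction `p` isolates `E i j` in the Koszul relation and commutes with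
  -- the two other shifts.
  have hk := congr_arg (shiftDown p)
    (koszul_of_eulerLagrange hE h (i := p) (j := i) (k := j) (Ne.symm hi) hij (Ne.symm hj))
  have c : ∀ {k : Fin N}, k ≠ p → ∀ f : Family N,
      shiftDown p (shiftUp k f) = shiftUp k (shiftDown p f) := fun hkp f =>
    LinearMap.congr_fun (commute_shiftDown_shiftUp (Ne.symm hkp)).eq f
  have e : shiftDown p (shiftUp p (E i j)) = E i j :=
    LinearMap.congr_fun (shiftDown_mul_shiftUp p) _
  rw [map_add, map_add, e, c hi, c hj, hE p j, map_neg, map_neg, map_zero] at hk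
  rw [hHi, hHj, ← sub_eq_zero, ← hk]
  abel

/-- Only the factor in the direction of the shift absorbs it; the other one passes through the total
derivative. -/
theorem antiVar_shiftUp {i j : Fin N} (h : i ≠ j) (f : Family N) :
    antiVar i (antiVar j (shiftUp i f)) = totalDer i (antiVar j f) := by
  change (antiVar i * antiVar j * shiftUp i) f = (totalDer i * antiVar j) f
  rw [(commute_antiVar i j).eq, mul_assoc, antiVar_mul_shiftUp, (commute_totalDer_antiVar h).eq]

theorem antiVar_comm (i j : Fin N) (f : Family N) :
    antiVar i (antiVar j f) = antiVar j (antiVar i f) :=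
  LinearMap.congr_fun (commute_antiVar i j).eq f

/-- The Euler–Lagrange equations make the two-form of operators exact. -/
theorem exists_primitive {A E : Fin N → Fin N → Family N} (hE : ∀ i j, E j i = -E i j)
    (hA : ∀ i j, i ≠ j → A i j = antiVar i (antiVar j (E i j)))
    (h : EulerLagrange E) {p q : Fin N} (hpq : p ≠ q) :
    ∃ η : Fin N → Family N, ∀ i j, i ≠ j → A i j = totalDer i (η j) - totalDer j (η i) := by
  obtain ⟨H, hH⟩ := exists_potential hE h hpq
  refine ⟨fun j => antiVar j (H j), fun i j hij => ?_⟩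
  rw [hA i j hij, hH i j hij, map_sub, map_sub, antiVar_shiftUp hij, antiVar_comm i j (shiftUp j _),
    antiVar_shiftUp hij.symm]

/-- If the two-form of operators is closed, then the Koszul relation holds. -/
theorem koszul_of_closed {A E : Fin N → Fin N → Family N}
    (hA : ∀ i j, i ≠ j → A i j = antiVar i (antiVar j (E i j))) {i j k : Fin N}
    (hij : i ≠ j) (hjk : j ≠ k) (hik : i ≠ k)
    (h : totalDer i (A j k) + totalDer j (A k i) + totalDer k (A i j) = 0) :
    shiftUp i (E j k) + shiftUp j (E k i) + shiftUp k (E i j) = 0 := by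
  have key : ∀ {i j k : Fin N}, i ≠ j → j ≠ k → i ≠ k →
      totalDer i (A j k) = antiVar i (antiVar j (antiVar k (shiftUp i (E j k)))) := by
    intro i j k hij hjk hik
    rw [hA j k hjk, antiVar_comm i j, antiVar_shiftUp hik]
    exact LinearMap.congr_fun (commute_totalDer_antiVar hij).eq _
  have e1 : ∀ f : Family N, antiVar j (antiVar k (antiVar i f))
      = antiVar i (antiVar j (antiVar k f)) := fun f => by
    rw [antiVar_comm k i, antiVar_comm j i]
  have e2 : ∀ f : Family N, antiVar k (antiVar i (antiVar j f))
      = antiVar i (antiVar j (antiVar k f)) := fun f => by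
    rw [antiVar_comm k i, antiVar_comm k j]
  rw [key hij hjk hik, key hjk hik.symm hij.symm, key hik.symm hij hjk.symm, e1, e2,
    ← map_add, ← map_add, ← map_add, ← map_add, ← map_add, ← map_add] at h
  refine antiVar_injective k (antiVar_injective j (antiVar_injective i ?_))
  simpa using h

/-! ### The families attached to a Lagrangian two-form and a field -/

/-- The family of the functions `∂L_{ij}/∂u_I` along the field `u`. -/
def LagrangianTwoForm.coeffFamily {n : ℕ} (L : LagrangianTwoForm N n) (u : smoothFun N)
    (i j : Fin N) : Family N :=
  Finsupp.onFinset (jetIndices N n)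
    (fun I => ⟨onJet u.1 (jetPartial I (L.coeff i j)),
      contDiff_onJet ((L.smooth i j).jetPartial I) (contDiff_coe u)⟩)
    (fun I hI => by
      by_contra hn
      rw [mem_jetIndices, not_le] at hn
      refine hI (Subtype.ext ?_)
      change onJet u.1 (jetPartial I (L.coeff i j)) = 0
      rw [jetPartial_eq_zero (L.smooth i j) hn]
      rfl)

/-- The family of the variational derivatives along the field `u`. -/
def LagrangianTwoForm.varFamily {n : ℕ} (L : LagrangianTwoForm N n) (u : smoothFun N)
    (i j : Fin N) : Family N :=
  varOp i (n + 1) (varOp j (n + 1) (L.coeffFamily u i j))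

variable {n : ℕ} (L : LagrangianTwoForm N n) (u : smoothFun N)

theorem coeffFamily_apply (i j : Fin N) (I : MultiIndex N) :
    (L.coeffFamily u i j I).1 = onJet u.1 (jetPartial I (L.coeff i j)) := rfl

theorem orderLT_coeffFamily (i j : Fin N) : OrderLT (n + 1) (L.coeffFamily u i j) := fun I hI =>
  Subtype.ext (by
    rw [coeffFamily_apply, jetPartial_eq_zero (L.smooth i j) (Nat.lt_of_succ_le hI)]; rfl)

theorem coeffFamily_antisymm (i j : Fin N) : L.coeffFamily u j i = -L.coeffFamily u i j := by
  refine Finsupp.ext fun I => Subtype.ext (funext fun t => ?_)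
  change jetPartial I (L.coeff j i) t (jet u.1 t) = -jetPartial I (L.coeff i j) t (jet u.1 t)
  have : L.coeff j i = fun t p => -L.coeff i j t p := by
    funext t p
    exact L.antisymm i j t p
  rw [this]
  exact deriv.fun_neg

theorem varFamily_antisymm (i j : Fin N) : L.varFamily u j i = -L.varFamily u i j := by
  rw [LagrangianTwoForm.varFamily, LagrangianTwoForm.varFamily, coeffFamily_antisymm, map_neg,
    map_neg]
  exact congr_arg Neg.neg (LinearMap.congr_fun (commute_varOp j i (n + 1)).eq _)

theorem coeffFamily_eq (i j : Fin N) :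
    L.coeffFamily u i j = antiVar i (antiVar j (L.varFamily u i j)) := by
  have h := orderLT_coeffFamily L u i j
  rw [LagrangianTwoForm.varFamily]
  -- Moving `antiVar j` past `varOp i` first means that the order bound is needed only for the
  -- original coefficient family.
  rw [antiVar_varOp_comm, antiVar_varOp j h, antiVar_varOp i h]

theorem varFamily_apply (i j : Fin N) (I : MultiIndex N) :
    (L.varFamily u i j I).1 = L.varDerivOn u.1 i j I := by
  funext t
  have hs : ∀ J, IsSmoothJetFunction n (jetPartial J (L.coeff i j)) := (L.smooth i j).jetPartial
  have hterm : ∀ a b : ℕ, ((totalD i)^[a] ((totalD j)^[b]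
      (jetPartial (I + Pi.single i a + Pi.single j b) (L.coeff i j)))) t (jet u.1 t)
      = (((der i : Module.End ℝ (smoothFun N)) ^ a) (((der j : Module.End ℝ (smoothFun N)) ^ b)
        (L.coeffFamily u i j (I + Pi.single i a + Pi.single j b)))).1 t := by
    intro a b
    have hu := contDiff_coe u
    have h1 := onJet_iterate_totalD j hu b (hs (I + Pi.single i a + Pi.single j b))
    have h2 := onJet_iterate_totalD i hu a h1.1
    rw [coe_der_pow, coe_der_pow, coeffFamily_apply, ← h1.2, ← h2.2]
    rfl
  rw [LagrangianTwoForm.varDerivOn, varDeriv,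
    finsum_eq_sum_of_support_subset (s := Finset.range (n + 1) ×ˢ Finset.range (n + 1)),
    Finset.sum_product, LagrangianTwoForm.varFamily]
  · simp only [varOp, LinearMap.sum_apply, Finsupp.finsetSum_apply, map_sum, step_pow_apply,
      AddSubmonoidClass.coe_finsetSum, Finset.sum_apply, hterm]
    rw [Finset.sum_comm]
    refine Finset.sum_congr rfl fun a _ => Finset.sum_congr rfl fun b _ => ?_
    rw [map_smul, smul_smul, pow_add]
    rfl
  -- If `a` or `b` exceeds `n`, the multi-index in the term has order above `n`, so the two
  -- truncations at `n + 1` lose nothing.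
  · intro ab hab
    by_contra hn
    refine hab ?_
    beta_reduce
    rw [hterm, orderLT_coeffFamily L u i j, map_zero, map_zero]
    · simp
    · rw [sum_add_single, sum_add_single]
      simp only [Finset.coe_product, Finset.coe_range, mem_prod, mem_Iio, not_and_or] at hn
      omega

theorem variation_eq (v : smoothFun N) (i j : Fin N) :
    L.variation u.1 v.1 i j = (pair v (L.coeffFamily u i j)).1 := by
  funext t
  rw [pair_apply]
  refine finsum_eq_sum_of_support_subset _ fun I hI => ?_
  rw [Finset.mem_coe, Finsupp.mem_support_iff]
  intro h
  refine hI ?_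
  have h' := congr_fun (congr_arg Subtype.val h) t
  rw [coeffFamily_apply] at h'
  change jetPartial I (L.coeff i j) t (jet u.1 t) = 0 at h'
  simp [h']

/-! ### Green's theorem on the unit square and Stokes' theorem on surfaces -/

theorem isCompact_unitSquare : IsCompact unitSquare := isCompact_Icc

theorem integrableOn_unitSquare {f : ℝ × ℝ → ℝ} (hf : Continuous f) :
    MeasureTheory.IntegrableOn f unitSquare :=
  hf.continuousOn.integrableOn_compact isCompact_unitSquare

theorem integral_green {P Q : ℝ × ℝ → ℝ} (hP : ContDiff ℝ ∞ P) (hQ : ContDiff ℝ ∞ Q) :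
    ∫ x in unitSquare, (fderiv ℝ Q x (1, 0) - fderiv ℝ P x (0, 1))
      = (∫ s in (0 : ℝ)..1, P (s, 0)) + (∫ s in (0 : ℝ)..1, Q (1, s))
        - (∫ s in (0 : ℝ)..1, P (s, 1)) - ∫ s in (0 : ℝ)..1, Q (0, s) := by
  have hc : ∀ {F : ℝ × ℝ → ℝ}, ContDiff ℝ ∞ F → ∀ c, Continuous fun x => fderiv ℝ F x c :=
    fun hF c => (hF.continuous_fderiv (by simp)).clm_apply continuous_const
  -- Green's formula is the divergence theorem for the field `(Q, -P)`.
  have h := MeasureTheory.integral_divergence_prod_Icc_of_hasFDerivAt_of_le Q (fun x => -P x)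
    (fderiv ℝ Q) (fun x => -fderiv ℝ P x) 0 1 zero_le_one hQ.continuous.continuousOn
    hP.continuous.neg.continuousOn
    (fun x _ => (hQ.differentiable (by simp) x).hasFDerivAt)
    (fun x _ => (hP.differentiable (by simp) x).hasFDerivAt.neg)
    (integrableOn_unitSquare ((hc hQ _).add (hc hP _).neg))
  simp only [neg_apply, ← sub_eq_add_neg, Prod.fst_zero, Prod.snd_zero, Prod.fst_one,
    Prod.snd_one, intervalIntegral.integral_neg] at h
  rw [unitSquare, h]
  ring

/-- The direction of an edge of the unit square. -/
def edgeDir : Fin 4 → ℝ × ℝ := ![(1, 0), (0, 1), (-1, 0), (0, -1)]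

theorem hasDerivAt_edge (e : Fin 4) (s : ℝ) : HasDerivAt (edge e) (edgeDir e) s := by
  have h1 : HasDerivAt (fun s : ℝ => 1 - s) (-1) s := by
    simpa using (hasDerivAt_id s).const_sub 1
  fin_cases e
  · exact (hasDerivAt_id s).prodMk (hasDerivAt_const s 0)
  · exact (hasDerivAt_const s 1).prodMk (hasDerivAt_id s)
  · exact h1.prodMk (hasDerivAt_const s 1)
  · exact (hasDerivAt_const s 0).prodMk h1

theorem integral_green_edges {P Q : ℝ × ℝ → ℝ} (hP : ContDiff ℝ ∞ P) (hQ : ContDiff ℝ ∞ Q) :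
    ∫ x in unitSquare, (fderiv ℝ Q x (1, 0) - fderiv ℝ P x (0, 1))
      = ∑ e, ∫ s in (0 : ℝ)..1,
        ((edgeDir e).1 * P (edge e s) + (edgeDir e).2 * Q (edge e s)) := by
  -- The top and left edges are run through backwards, hence the substitution `s ↦ 1 - s`.
  have h1 := intervalIntegral.integral_comp_sub_left (a := 0) (b := 1) (fun s => P (s, 1)) 1
  have h2 := intervalIntegral.integral_comp_sub_left (a := 0) (b := 1) (fun s => Q (0, s)) 1
  rw [sub_self, sub_zero] at h1 h2
  rw [integral_green hP hQ, ← h1, ← h2, Fin.sum_univ_four]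
  simp [edge, edgeDir]
  ring

/-- The integral of the one-form `∑_j g_j dt_j` along a curve. -/
def lineIntegral (g : Fin N → MultiTime N → ℝ) (c : ℝ → MultiTime N) : ℝ :=
  ∫ s in (0 : ℝ)..1, ∑ j, g j (c s) * deriv c s j

theorem lineIntegral_reverse (g : Fin N → MultiTime N → ℝ) {c d : ℝ → MultiTime N}
    (h : ∀ s ∈ Icc (0 : ℝ) 1, c s = d (1 - s)) : lineIntegral g c = -lineIntegral g d := by
  have h1 := intervalIntegral.integral_comp_sub_left (a := 0) (b := 1)
    (fun s => ∑ j, g j (d s) * deriv d s j) 1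
  rw [sub_self, sub_zero] at h1
  -- The curves agree only on the closed interval, so their derivatives are compared on the open
  -- one.
  rw [lineIntegral, lineIntegral, ← h1, ← intervalIntegral.integral_neg,
    intervalIntegral.integral_of_le zero_le_one, intervalIntegral.integral_of_le zero_le_one,
    MeasureTheory.integral_Ioc_eq_integral_Ioo, MeasureTheory.integral_Ioc_eq_integral_Ioo]
  refine MeasureTheory.setIntegral_congr_fun measurableSet_Ioo fun s hs => ?_
  have hev : c =ᶠ[nhds s] fun s => d (1 - s) := by
    filter_upwards [Icc_mem_nhds hs.1 hs.2] with r hr using h r hr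
  rw [hev.deriv_eq, deriv_comp_const_sub, h s (Ioo_subset_Icc_self hs), ← Finset.sum_neg_distrib]
  refine Finset.sum_congr rfl fun j _ => ?_
  rw [Pi.neg_apply, mul_neg]

/-- The diagonal vanishes, and exchanging indices turns the half with `j < i` into the subtracted
products. -/
theorem sum_lt_eq_sum {w : Fin N → Fin N → ℝ} (hw : ∀ i j, w j i = -w i j) (a b : Fin N → ℝ) :
    ∑ i, ∑ j ∈ Finset.univ.filter (fun j => i < j), w i j * (a i * b j - a j * b i)
      = ∑ i, ∑ j, w i j * (a i * b j) := by
  have h : ∀ i j, w i j * (a i * b j) = (if i < j then w i j * (a i * b j) else 0)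
      + (if j < i then w i j * (a i * b j) else 0) := by
    intro i j
    rcases lt_trichotomy i j with hij | rfl | hij
    · simp [hij, hij.le]
    · have : w i i = 0 := by linarith [hw i i]
      simp [this]
    · simp [hij, hij.le]
  simp only [Finset.sum_filter]
  rw [Finset.sum_congr rfl fun i _ => Finset.sum_congr rfl fun j _ => h i j]
  simp only [Finset.sum_add_distrib]
  rw [Finset.sum_comm (f := fun i j => if j < i then w i j * (a i * b j) else 0),
    ← Finset.sum_add_distrib]
  refine Finset.sum_congr rfl fun i _ => ?_
  rw [← Finset.sum_add_distrib]
  refine Finset.sum_congr rfl fun j _ => ?_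
  split_ifs
  · rw [hw i j]; ring
  · ring

theorem fderiv_eq_sum (g : MultiTime N → ℝ) (t a : MultiTime N) :
    fderiv ℝ g t a = ∑ i, a i * partialD i g t := by
  refine ((fderiv ℝ g t).toLinearMap.pi_apply_eq_sum_univ a).trans ?_
  simp only [partialD, smul_eq_mul, ContinuousLinearMap.coe_coe]
  refine Finset.sum_congr rfl fun i _ => ?_
  congr 2
  funext j
  simp [Pi.single_apply, eq_comm]

theorem fderiv_fderiv_comm {f : ℝ × ℝ → MultiTime N} (hf : ContDiff ℝ ∞ f) (x a b : ℝ × ℝ)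
    (j : Fin N) :
    fderiv ℝ (fun x => fderiv ℝ f x a j) x b = fderiv ℝ (fun x => fderiv ℝ f x b j) x a := by
  have key : ∀ a b : ℝ × ℝ, fderiv ℝ (fun x => fderiv ℝ f x a j) x b
      = fderiv ℝ (fderiv ℝ f) x b a j := by
    intro a b
    have h := ((hf.fderiv_right (m := ∞) (by simp)).differentiable (by simp) x).hasFDerivAt
    have h' := hasFDerivAt_pi'.1 (h.clm_apply (hasFDerivAt_const a x)) j
    rw [h'.fderiv]
    simp
  have hs : IsSymmSndFDerivAt ℝ f x := hf.contDiffAt.isSymmSndFDerivAt (by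
    rw [minSmoothness_of_isRCLikeNormedField]
    exact WithTop.coe_le_coe.2 le_top)
  rw [key, key, hs.eq]

/-- A component of the pullback of the one-form `∑_j g_j dt_j` to a tile. -/
def pullback (g : Fin N → MultiTime N → ℝ) (f : ℝ × ℝ → MultiTime N) (c : ℝ × ℝ) : ℝ × ℝ → ℝ :=
  fun x => ∑ j, g j (f x) * fderiv ℝ f x c j

theorem contDiff_fderiv_apply {f : ℝ × ℝ → MultiTime N} (hf : ContDiff ℝ ∞ f) (c : ℝ × ℝ)
    (j : Fin N) : ContDiff ℝ ∞ fun x => fderiv ℝ f x c j :=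
  (contDiff_apply ℝ ℝ j).comp ((hf.fderiv_right (m := ∞) (by simp)).clm_apply contDiff_const)

theorem contDiff_pullback {g : Fin N → MultiTime N → ℝ} (hg : ∀ j, ContDiff ℝ ∞ (g j))
    {f : ℝ × ℝ → MultiTime N} (hf : ContDiff ℝ ∞ f) (c : ℝ × ℝ) :
    ContDiff ℝ ∞ (pullback g f c) :=
  ContDiff.sum fun j _ => ((hg j).comp hf).mul (contDiff_fderiv_apply hf c j)

theorem fderiv_pullback {g : Fin N → MultiTime N → ℝ} (hg : ∀ j, ContDiff ℝ ∞ (g j))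
    {f : ℝ × ℝ → MultiTime N} (hf : ContDiff ℝ ∞ f) (c d x : ℝ × ℝ) :
    fderiv ℝ (pullback g f c) x d
      = ∑ j, ((∑ i, fderiv ℝ f x d i * partialD i (g j) (f x)) * fderiv ℝ f x c j
        + g j (f x) * fderiv ℝ (fun x => fderiv ℝ f x c j) x d) := by
  have hd : ∀ j ∈ Finset.univ, HasFDerivAt (fun x => g j (f x) * fderiv ℝ f x c j)
      (g j (f x) • fderiv ℝ (fun x => fderiv ℝ f x c j) x
        + fderiv ℝ f x c j • (fderiv ℝ (g j) (f x)).comp (fderiv ℝ f x)) x := fun j _ =>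
    HasFDerivAt.mul (((hg j).differentiable (by simp) _).hasFDerivAt.comp x
      (hf.differentiable (by simp) x).hasFDerivAt)
      ((contDiff_fderiv_apply hf c j).differentiable (by simp) x).hasFDerivAt
  have h := HasFDerivAt.fun_sum hd
  unfold pullback
  rw [h.fderiv, sum_apply]
  refine Finset.sum_congr rfl fun j _ => ?_
  rw [← fderiv_eq_sum]
  simp
  ring

/-- Pullback commutes with the exterior derivative: the second derivatives of `f` cancel by
symmetry. -/
theorem pullback_exterior {g : Fin N → MultiTime N → ℝ} (hg : ∀ j, ContDiff ℝ ∞ (g j))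
    {f : ℝ × ℝ → MultiTime N} (hf : ContDiff ℝ ∞ f) (x : ℝ × ℝ) :
    ∑ i, ∑ j ∈ Finset.univ.filter (fun j => i < j),
      (partialD i (g j) (f x) - partialD j (g i) (f x)) *
        (fderiv ℝ f x (1, 0) i * fderiv ℝ f x (0, 1) j
          - fderiv ℝ f x (1, 0) j * fderiv ℝ f x (0, 1) i)
      = fderiv ℝ (pullback g f (0, 1)) x (1, 0) - fderiv ℝ (pullback g f (1, 0)) x (0, 1) := by
  rw [sum_lt_eq_sum (w := fun i j => partialD i (g j) (f x) - partialD j (g i) (f x))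
    (fun i j => by ring), fderiv_pullback hg hf, fderiv_pullback hg hf]
  simp only [Finset.sum_add_distrib, fderiv_fderiv_comm hf x (0, 1) (1, 0), sub_mul,
    Finset.sum_sub_distrib]
  rw [add_sub_add_right_eq_sub, Finset.sum_comm]
  congr 1
  · refine Finset.sum_congr rfl fun j _ => ?_
    rw [Finset.sum_mul]
    exact Finset.sum_congr rfl fun i _ => by ring
  · refine Finset.sum_congr rfl fun j _ => ?_
    rw [Finset.sum_mul]
    exact Finset.sum_congr rfl fun i _ => by ring

theorem Surface.integral_congr (S : Surface N) {w w' : Fin N → Fin N → MultiTime N → ℝ}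
    (h : ∀ i j, i ≠ j → w i j = w' i j) : S.integral w = S.integral w' := by
  unfold Surface.integral
  refine Finset.sum_congr rfl fun a _ => ?_
  congr 1
  funext x
  refine Finset.sum_congr rfl fun i _ => Finset.sum_congr rfl fun j hj => ?_
  rw [h i j (Finset.mem_filter.1 hj).2.ne]

/-- **Stokes' theorem** for one-forms that vanish on the boundary of a surface. -/
theorem Surface.integral_exterior (S : Surface N) {g : Fin N → MultiTime N → ℝ}
    (hg : ∀ j, ContDiff ℝ ∞ (g j)) (hb : ∀ j, ∀ q ∈ S.boundary, g j q = 0) :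
    S.integral (fun i j t => partialD i (g j) t - partialD j (g i) t) = 0 := by
  let B : Fin S.numTiles × Fin 4 → ℝ := fun e =>
    lineIntegral g fun s => S.tile e.1 (edge e.2 s)
  have h1 : S.integral (fun i j t => partialD i (g j) t - partialD j (g i) t) = ∑ e, B e := by
    rw [Surface.integral, Fintype.sum_prod_type]
    refine Finset.sum_congr rfl fun a _ => ?_
    have hf := S.smooth a
    simp only [pullback_exterior hg hf]
    rw [integral_green_edges (contDiff_pullback hg hf _) (contDiff_pullback hg hf _)]
    refine Finset.sum_congr rfl fun e _ => ?_
    simp only [B, lineIntegral]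
    congr 1
    funext s
    have hd : HasDerivAt (fun s => S.tile a (edge e s))
        (fderiv ℝ (S.tile a) (edge e s) (edgeDir e)) s :=
      (hf.differentiable (by simp) _).hasFDerivAt.comp_hasDerivAt s (hasDerivAt_edge e s)
    have he : edgeDir e = (edgeDir e).1 • ((1, 0) : ℝ × ℝ) + (edgeDir e).2 • ((0, 1) : ℝ × ℝ) := by
      ext <;> simp
    rw [hd.deriv]
    conv_rhs => rw [he]
    simp only [pullback, Finset.mul_sum, ← Finset.sum_add_distrib, map_add, map_smul,
      Pi.add_apply, Pi.smul_apply, smul_eq_mul]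
    exact Finset.sum_congr rfl fun j _ => by ring
  -- On a free edge the form vanishes; glued edges are traversed in opposite directions. Reindexing
  -- by the involution then shows that the total equals its own negative.
  have h2 : ∀ e, B (S.glue e) = -B e := by
    intro e
    by_cases he : S.glue e = e
    · have h0 : B e = 0 := by
        simp only [B, lineIntegral]
        rw [intervalIntegral.integral_congr (g := fun _ => 0)]
        · simp
        · intro s hs
          rw [uIcc_of_le zero_le_one] at hs
          refine Finset.sum_eq_zero fun j _ => ?_
          rw [hb j _ ⟨e, he, s, hs, rfl⟩, zero_mul]
      rw [he, h0, neg_zero]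
    · rw [eq_neg_iff_add_eq_zero, add_comm, ← eq_neg_iff_add_eq_zero]
      exact lineIntegral_reverse g fun s hs => S.compatible e he s hs
  have h3 : ∑ e, B e = ∑ e, B (S.glue e) :=
    (Equiv.sum_comp (Function.Involutive.toPerm S.glue S.glue_glue) B).symm
  rw [h1]
  have : ∑ e, B (S.glue e) = -∑ e, B e := by simp only [h2, Finset.sum_neg_distrib]
  linarith

/-- The Euler–Lagrange equations are sufficient for criticality on all surfaces. -/
theorem isCriticalOn_of_eulerLagrange {n : ℕ} (L : LagrangianTwoForm N n) (u : smoothFun N)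
    (h : EulerLagrange (L.varFamily u)) (S : Surface N) : L.IsCriticalOn u.1 S := by
  intro v hv hd
  let V : smoothFun N := ⟨v, hv⟩
  by_cases hN : ∃ p q : Fin N, p ≠ q
  · obtain ⟨p, q, hpq⟩ := hN
    obtain ⟨η, hη⟩ := exists_primitive (varFamily_antisymm L u)
      (fun i j _ => coeffFamily_eq L u i j) h hpq
    rw [S.integral_congr (w' := fun i j t =>
      partialD i (pair V (η j)).1 t - partialD j (pair V (η i)).1 t)]
    · refine S.integral_exterior (g := fun j => (pair V (η j)).1) (fun j => contDiff_coe _)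
        fun j q hq => ?_
      exact pair_eq_zero_of_notMem (fun hq' => hd.le_bot ⟨hq', hq⟩) _
    · intro i j hij
      rw [variation_eq L u V, hη i j hij, map_sub, ← der_pair, ← der_pair]
      rfl
  -- With at most one coordinate there are no pairs `i < j`, and the integrand is an empty sum.
  · push Not at hN
    rw [Surface.integral]
    refine Finset.sum_eq_zero fun a _ => ?_
    have : ∀ i j : Fin N, ¬ i < j := fun i j hij => hij.ne (hN i j)
    simp [this]

/-! ### Test functions -/

/-- The exponential function `exp (∑_k ξ_k t_k)`. -/
def expFun (ξ : Fin N → ℝ) : smoothFun N :=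
  ⟨fun t => Real.exp (∑ k, ξ k * t k), (Real.contDiff_exp.comp
    (ContDiff.sum fun k _ => contDiff_const.mul (contDiff_apply ℝ ℝ k)) :
      ContDiff ℝ ∞ fun t : MultiTime N => Real.exp (∑ k, ξ k * t k))⟩

theorem der_expFun (i : Fin N) (ξ : Fin N → ℝ) : der i (expFun ξ) = ξ i • expFun ξ := by
  ext t
  have h : HasFDerivAt (fun t : MultiTime N => ∑ k, ξ k * t k)
      (∑ k, ξ k • (ContinuousLinearMap.proj k : MultiTime N →L[ℝ] ℝ)) t :=
    HasFDerivAt.fun_sum fun k _ => (hasFDerivAt_apply k t).const_mul (ξ k)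
  change fderiv ℝ (fun t : MultiTime N => Real.exp (∑ k, ξ k * t k)) t (Pi.single i 1)
    = ξ i * Real.exp (∑ k, ξ k * t k)
  rw [h.exp.fderiv]
  simp [Pi.single_apply, mul_comm]

theorem iterDer_expFun (I : MultiIndex N) (ξ : Fin N → ℝ) :
    iterDer I (expFun ξ) = (∏ k, ξ k ^ I k) • expFun ξ := by
  have hp : ∀ (i : Fin N) (a : ℕ) (c : ℝ),
      ((der i : Module.End ℝ (smoothFun N)) ^ a) (c • expFun ξ) = (ξ i ^ a * c) • expFun ξ := by
    intro i a c
    induction a with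
    | zero => simp
    | succ a ih =>
      rw [pow_succ', Module.End.mul_apply, ih, map_smul, der_expFun, smul_smul]
      congr 1
      ring
  rw [Fin.prod_univ_def, iterDer]
  induction List.finRange N with
  | nil => simp
  | cons i l ih =>
    rw [List.map_cons, List.prod_cons, List.map_cons, List.prod_cons, Module.End.mul_apply, ih, hp]

theorem pair_expFun (ξ : Fin N → ℝ) (f : Family N) (t : MultiTime N) :
    (pair (expFun ξ) f).1 t
      = (∑ I ∈ f.support, (f I).1 t * ∏ k, ξ k ^ I k) * (expFun ξ).1 t := by
  rw [pair_apply, Finset.sum_mul]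
  refine Finset.sum_congr rfl fun I _ => ?_
  rw [← coe_iterDer, iterDer_expFun, mul_assoc]
  rfl

/-- A differential operator that kills all exponential functions at a point has zero coefficients
there. -/
theorem coeff_eq_zero_of_pair_expFun {f : Family N} {t : MultiTime N}
    (h : ∀ ξ : Fin N → ℝ, (pair (expFun ξ) f).1 t = 0) (I : MultiIndex N) : (f I).1 t = 0 := by
  let e : MultiIndex N ≃ (Fin N →₀ ℕ) := Finsupp.equivFunOnFinite.symm
  -- The symbol of the operator at `t`. Its value at `ξ` is the pairing with `expFun ξ` divided by a
  -- positive exponential, so it vanishes identically.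
  let p : MvPolynomial (Fin N) ℝ := ∑ I ∈ f.support, MvPolynomial.monomial (e I) ((f I).1 t)
  have hp : p = 0 := by
    refine MvPolynomial.funext fun ξ => ?_
    have h1 := h ξ
    rw [pair_expFun] at h1
    rw [map_sum, map_zero, ← (mul_eq_zero.1 h1).resolve_right (Real.exp_pos _).ne']
    refine Finset.sum_congr rfl fun I _ => ?_
    rw [MvPolynomial.eval_monomial, Finsupp.prod_fintype _ _ (by simp)]
    rfl
  by_cases hI : I ∈ f.support
  · have hc := congr_arg (MvPolynomial.coeff (e I)) hp
    simp only [p, MvPolynomial.coeff_sum, MvPolynomial.coeff_monomial, e.injective.eq_iff,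
      Finset.sum_ite_eq', if_pos hI, MvPolynomial.coeff_zero] at hc
    exact hc
  · rw [Finsupp.notMem_support_iff.1 hI]
    rfl

/-- The open unit square. -/
def openSquare : Set (ℝ × ℝ) := Ioo 0 1 ×ˢ Ioo 0 1

theorem isOpen_openSquare : IsOpen openSquare := isOpen_Ioo.prod isOpen_Ioo

theorem openSquare_subset : openSquare ⊆ unitSquare := fun _ hx =>
  ⟨⟨hx.1.1.le, hx.2.1.le⟩, ⟨hx.1.2.le, hx.2.2.le⟩⟩

theorem edge_notMem_openSquare (e : Fin 4) (s : ℝ) : edge e s ∉ openSquare := by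
  fin_cases e <;> simp [edge, openSquare]

/-- The fundamental lemma of the calculus of variations on the unit square. -/
theorem eq_zero_of_integral_mul_eq_zero {h : ℝ × ℝ → ℝ} (hh : Continuous h)
    (H : ∀ ψ : ℝ × ℝ → ℝ, ContDiff ℝ ∞ ψ → tsupport ψ ⊆ openSquare →
      ∫ x in unitSquare, ψ x * h x = 0) {x : ℝ × ℝ} (hx : x ∈ openSquare) : h x = 0 := by
  have hae : ∀ᵐ x ∂(MeasureTheory.volume : MeasureTheory.Measure (ℝ × ℝ)),
      x ∈ openSquare → h x = 0 := by
    refine isOpen_openSquare.ae_eq_zero_of_integral_contDiff_smul_eq_zero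
      (hh.locallyIntegrable.locallyIntegrableOn _) fun ψ hψ _ hs => ?_
    rw [← H ψ hψ hs]
    refine (MeasureTheory.setIntegral_eq_integral_of_forall_compl_eq_zero fun x hx => ?_).symm
    rw [image_eq_zero_of_notMem_tsupport fun hx' => hx (openSquare_subset (hs hx')), zero_smul]
  have hae' : h =ᵐ[MeasureTheory.volume.restrict openSquare] fun _ => 0 := by
    rw [Filter.EventuallyEq, MeasureTheory.ae_restrict_iff' isOpen_openSquare.measurableSet]
    exact hae
  -- Continuity upgrades vanishing almost everywhere to vanishing everywhere on the open square.
  exact MeasureTheory.Measure.eqOn_open_of_ae_eq hae' isOpen_openSquare hh.continuousOn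
    continuousOn_const hx

/-! ### Graphs over coordinate squares -/

/-- The parametrization of the graph of the function `f`, with values in the direction `c`, over a
square parallel to the coordinate plane `i`, `j`. -/
def graphMap (p c : MultiTime N) (i j : Fin N) (f : ℝ × ℝ → ℝ) : ℝ × ℝ → MultiTime N :=
  fun x => p + (x.1 • Pi.single i 1 + x.2 • Pi.single j 1 + f x • c)

theorem contDiff_graphMap (p c : MultiTime N) (i j : Fin N) {f : ℝ × ℝ → ℝ}
    (hf : ContDiff ℝ ∞ f) : ContDiff ℝ ∞ (graphMap p c i j f) :=
  contDiff_const.add (((contDiff_fst.smul contDiff_const).add (contDiff_snd.smul contDiff_const)).add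
    (hf.smul contDiff_const))

theorem fderiv_graphMap (p c : MultiTime N) (i j : Fin N) {f : ℝ × ℝ → ℝ}
    (hf : ContDiff ℝ ∞ f) (x d : ℝ × ℝ) :
    fderiv ℝ (graphMap p c i j f) x d
      = d.1 • Pi.single i 1 + d.2 • Pi.single j 1 + fderiv ℝ f x d • c := by
  have h : HasFDerivAt (graphMap p c i j f)
      (((ContinuousLinearMap.fst ℝ ℝ ℝ).smulRight (Pi.single i 1 : MultiTime N)
        + (ContinuousLinearMap.snd ℝ ℝ ℝ).smulRight (Pi.single j 1 : MultiTime N))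
        + (fderiv ℝ f x).smulRight c) x :=
    ((((hasFDerivAt_fst (p := x)).smul_const _).add ((hasFDerivAt_snd (p := x)).smul_const _)).add
      ((hf.differentiable (by simp) x).hasFDerivAt.smul_const c)).const_add p
  rw [h.fderiv]
  rfl

theorem graphMap_apply_fst (p : MultiTime N) {c : MultiTime N} {i j : Fin N} (hij : i ≠ j)
    (hc : c i = 0) (f : ℝ × ℝ → ℝ) (x : ℝ × ℝ) : graphMap p c i j f x i = p i + x.1 := by
  simp [graphMap, hij, hc]

theorem graphMap_apply_snd (p : MultiTime N) {c : MultiTime N} {i j : Fin N} (hij : i ≠ j)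
    (hc : c j = 0) (f : ℝ × ℝ → ℝ) (x : ℝ × ℝ) : graphMap p c i j f x j = p j + x.2 := by
  simp [graphMap, hij.symm, hc]

/-- The graph of a smooth function over a coordinate square as a surface made of one tile. -/
def graphSurface (p : MultiTime N) {c : MultiTime N} {i j : Fin N} (hij : i ≠ j) (hi : c i = 0)
    (hj : c j = 0) {f : ℝ × ℝ → ℝ} (hf : ContDiff ℝ ∞ f) : Surface N where
  numTiles := 1
  tile _ := graphMap p c i j f
  glue := id
  smooth _ := contDiff_graphMap p c i j hf
  immersion _ x _ := by
    -- Since `c` has no component along `i` or `j`, those two coordinates recover the parameters;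
    -- the same reason gives injectivity of the tile below.
    refine (injective_iff_map_eq_zero (fderiv ℝ (graphMap p c i j f) x)).2 fun d hd => ?_
    rw [fderiv_graphMap p c i j hf] at hd
    have h1 := congr_fun hd i
    have h2 := congr_fun hd j
    simp [hij, hij.symm, hi, hj] at h1 h2
    exact Prod.ext h1 h2
  glue_glue _ := rfl
  compatible e he := absurd rfl he
  injective a b x _ y _ h := by
    have h1 := congr_fun h i
    have h2 := congr_fun h j
    rw [graphMap_apply_fst p hij hi, graphMap_apply_fst p hij hi, add_right_inj] at h1
    rw [graphMap_apply_snd p hij hj, graphMap_apply_snd p hij hj, add_right_inj] at h2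
    rw [Subsingleton.elim a b, Prod.ext h1 h2]
    exact Relation.EqvGen.refl _

theorem graphSurface_integral (p : MultiTime N) {c : MultiTime N} {i j : Fin N} (hij : i ≠ j)
    (hi : c i = 0) (hj : c j = 0) {f : ℝ × ℝ → ℝ} (hf : ContDiff ℝ ∞ f)
    {w : Fin N → Fin N → MultiTime N → ℝ} (hw : ∀ i j t, w j i t = -w i j t) :
    (graphSurface p hij hi hj hf).integral w = ∫ x in unitSquare,
      ∑ k, ∑ l, w k l (graphMap p c i j f x) *
        (((Pi.single i 1 + fderiv ℝ f x (1, 0) • c : MultiTime N) k) *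
          ((Pi.single j 1 + fderiv ℝ f x (0, 1) • c : MultiTime N) l)) := by
  rw [Surface.integral]
  change ∑ a : Fin 1, _ = _
  rw [Fin.sum_univ_one]
  congr 1
  funext x
  change ∑ i', ∑ j' ∈ Finset.univ.filter (fun j' => i' < j'), w i' j' (graphMap p c i j f x) *
    (fderiv ℝ (graphMap p c i j f) x (1, 0) i' * fderiv ℝ (graphMap p c i j f) x (0, 1) j'
      - fderiv ℝ (graphMap p c i j f) x (1, 0) j' * fderiv ℝ (graphMap p c i j f) x (0, 1) i') = _
  rw [sum_lt_eq_sum (w := fun k l => w k l (graphMap p c i j f x)) fun i j => hw i j _]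
  simp only [fderiv_graphMap p c i j hf, one_smul, zero_smul, add_zero, zero_add]

/-- A cutoff function that depends only on the coordinates `t_i`, `t_j`. -/
def cylinder (p : MultiTime N) (i j : Fin N) {ψ : ℝ × ℝ → ℝ} (hψ : ContDiff ℝ ∞ ψ) :
    smoothFun N :=
  ⟨fun t => ψ (t i - p i, t j - p j), hψ.comp
    (((contDiff_apply ℝ ℝ i).sub contDiff_const).prodMk
      ((contDiff_apply ℝ ℝ j).sub contDiff_const))⟩

theorem cylinder_graphMap (p : MultiTime N) {c : MultiTime N} {i j : Fin N} (hij : i ≠ j)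
    (hi : c i = 0) (hj : c j = 0) (f : ℝ × ℝ → ℝ) {ψ : ℝ × ℝ → ℝ} (hψ : ContDiff ℝ ∞ ψ)
    (x : ℝ × ℝ) : (cylinder p i j hψ).1 (graphMap p c i j f x) = ψ x := by
  change ψ (graphMap p c i j f x i - p i, graphMap p c i j f x j - p j) = ψ x
  rw [graphMap_apply_fst p hij hi, graphMap_apply_snd p hij hj, add_sub_cancel_left,
    add_sub_cancel_left]

theorem mem_tsupport_of_cylinder {p : MultiTime N} {i j : Fin N} {ψ : ℝ × ℝ → ℝ}
    {hψ : ContDiff ℝ ∞ ψ} (w : smoothFun N) {t : MultiTime N}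
    (ht : t ∈ tsupport (cylinder p i j hψ * w).1) : (t i - p i, t j - p j) ∈ tsupport ψ := by
  by_contra hn
  refine (notMem_tsupport_iff_eventuallyEq.2 ?_) ht
  have hc : Continuous fun t : MultiTime N => (t i - p i, t j - p j) := by fun_prop
  filter_upwards [hc.continuousAt.eventually (notMem_tsupport_iff_eventuallyEq.1 hn)] with s hs
  change ψ (s i - p i, s j - p j) * w.1 s = 0
  rw [hs, Pi.zero_apply, zero_mul]

theorem graphMap_edge_notMem (p : MultiTime N) {c : MultiTime N} {i j : Fin N} (hij : i ≠ j)
    (hi : c i = 0) (hj : c j = 0) (f : ℝ × ℝ → ℝ) {ψ : ℝ × ℝ → ℝ} {hψ : ContDiff ℝ ∞ ψ}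
    (hs : tsupport ψ ⊆ openSquare) (w : smoothFun N) {x : ℝ × ℝ} (hx : x ∉ openSquare) :
    graphMap p c i j f x ∉ tsupport (cylinder p i j hψ * w).1 := by
  intro ht
  have := hs (mem_tsupport_of_cylinder w ht)
  rw [graphMap_apply_fst p hij hi, graphMap_apply_snd p hij hj, add_sub_cancel_left,
    add_sub_cancel_left] at this
  exact hx this

theorem disjoint_boundary_graphSurface (p : MultiTime N) {c : MultiTime N} {i j : Fin N}
    (hij : i ≠ j) (hi : c i = 0) (hj : c j = 0) {f : ℝ × ℝ → ℝ} (hf : ContDiff ℝ ∞ f)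
    {ψ : ℝ × ℝ → ℝ} {hψ : ContDiff ℝ ∞ ψ} (hs : tsupport ψ ⊆ openSquare) (w : smoothFun N) :
    Disjoint (tsupport (cylinder p i j hψ * w).1) (graphSurface p hij hi hj hf).boundary := by
  rw [disjoint_left]
  rintro _ ht ⟨e, -, s, -, rfl⟩
  exact graphMap_edge_notMem p hij hi hj f hs w (edge_notMem_openSquare e.2 s) ht

theorem der_cylinder (p : MultiTime N) {i j k : Fin N} (hik : k ≠ i) (hjk : k ≠ j)
    {ψ : ℝ × ℝ → ℝ} (hψ : ContDiff ℝ ∞ ψ) : der k (cylinder p i j hψ) = 0 := by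
  ext t
  have hd : HasFDerivAt (fun t : MultiTime N => (t i - p i, t j - p j))
      ((ContinuousLinearMap.proj i : MultiTime N →L[ℝ] ℝ).prod (ContinuousLinearMap.proj j)) t :=
    ((hasFDerivAt_apply i t).sub_const _).prodMk ((hasFDerivAt_apply j t).sub_const _)
  change fderiv ℝ (ψ ∘ fun t : MultiTime N => (t i - p i, t j - p j)) t (Pi.single k 1) = 0
  rw [((hψ.differentiable (by simp) _).hasFDerivAt.comp t hd).fderiv]
  simp [hik.symm, hjk.symm, ← Prod.zero_eq_mk]

theorem iterDer_cylinder_mul (p : MultiTime N) {i j : Fin N} {ψ : ℝ × ℝ → ℝ}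
    (hψ : ContDiff ℝ ∞ ψ) (w : smoothFun N) {I : MultiIndex N} (hi : I i = 0) (hj : I j = 0) :
    iterDer I (cylinder p i j hψ * w) = cylinder p i j hψ * iterDer I w := by
  have hp : ∀ (k : Fin N) (w : smoothFun N), ((der k : Module.End ℝ (smoothFun N)) ^ I k)
      (cylinder p i j hψ * w)
      = cylinder p i j hψ * ((der k : Module.End ℝ (smoothFun N)) ^ I k) w := by
    intro k w
    by_cases hki : k = i
    · rw [hki, hi]; rfl
    by_cases hkj : k = j
    · rw [hkj, hj]; rfl
    induction I k with
    | zero => rfl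
    | succ a ih =>
      rw [pow_succ', Module.End.mul_apply, ih, der_mul, der_cylinder p hki hkj, zero_mul, zero_add]
      rfl
  unfold iterDer
  induction List.finRange N with
  | nil => rfl
  | cons k l ih =>
    rw [List.map_cons, List.prod_cons, Module.End.mul_apply, ih, hp]
    rfl

/-- The cutoff is constant in all directions other than `i` and `j`, so an operator without
derivatives in these two treats it as a scalar. -/
theorem pair_cylinder_mul (p : MultiTime N) {i j : Fin N} {ψ : ℝ × ℝ → ℝ}
    (hψ : ContDiff ℝ ∞ ψ) (w : smoothFun N) {f : Family N}
    (hf : ∀ I, f I ≠ 0 → I i = 0 ∧ I j = 0) :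
    pair (cylinder p i j hψ * w) f = cylinder p i j hψ * pair w f := by
  have h : ∀ v : smoothFun N, pair v f = ∑ I ∈ f.support, f I * iterDer I v := fun _ => rfl
  rw [h, h, Finset.mul_sum]
  refine Finset.sum_congr rfl fun I hI => ?_
  obtain ⟨hi, hj⟩ := hf I (Finsupp.mem_support_iff.1 hI)
  rw [iterDer_cylinder_mul p hψ w hi hj]
  ring

/-! ### Necessity of the Euler–Lagrange equations -/

theorem integral_green_eq_zero {P Q : ℝ × ℝ → ℝ} (hP : ContDiff ℝ ∞ P) (hQ : ContDiff ℝ ∞ Q)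
    (hP0 : ∀ x ∉ openSquare, P x = 0) (hQ0 : ∀ x ∉ openSquare, Q x = 0) :
    ∫ x in unitSquare, (fderiv ℝ Q x (1, 0) - fderiv ℝ P x (0, 1)) = 0 := by
  rw [integral_green_edges hP hQ]
  simp [hP0 _ (edge_notMem_openSquare _ _), hQ0 _ (edge_notMem_openSquare _ _)]

theorem fderiv_comp_graphMap {g : MultiTime N → ℝ} (hg : ContDiff ℝ ∞ g) (p c : MultiTime N)
    (i j : Fin N) {f : ℝ × ℝ → ℝ} (hf : ContDiff ℝ ∞ f) (x d : ℝ × ℝ) :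
    fderiv ℝ (fun x => g (graphMap p c i j f x)) x d
      = d.1 * partialD i g (graphMap p c i j f x) + d.2 * partialD j g (graphMap p c i j f x)
        + fderiv ℝ f x d * fderiv ℝ g (graphMap p c i j f x) c := by
  have h := (hg.differentiable (by simp) (graphMap p c i j f x)).hasFDerivAt.comp x
    ((contDiff_graphMap p c i j hf).differentiable (by simp) x).hasFDerivAt
  change fderiv ℝ (g ∘ graphMap p c i j f) x d = _
  rw [h.fderiv, ContinuousLinearMap.comp_apply, fderiv_graphMap p c i j hf, map_add, map_add,
    map_smul, map_smul, map_smul]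
  rfl

theorem sum_single_mul_single (w : Fin N → Fin N → ℝ) (i j : Fin N) :
    ∑ k, ∑ l, w k l * ((Pi.single i 1 : MultiTime N) k * (Pi.single j 1 : MultiTime N) l)
      = w i j := by
  simp [Pi.single_apply]

theorem variation_antisymm {n : ℕ} (L : LagrangianTwoForm N n) (u v : smoothFun N) (i j : Fin N)
    (t : MultiTime N) : L.variation u.1 v.1 j i t = -L.variation u.1 v.1 i j t := by
  rw [variation_eq, variation_eq, coeffFamily_antisymm, map_neg]
  rfl

/-- The part of a family at the multi-indices which do not involve `i` and `j`. -/
def transversal (i j : Fin N) (f : Family N) : Family N :=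
  (1 - shiftUp i * shiftDown i : Module.End ℝ (Family N))
    ((1 - shiftUp j * shiftDown j : Module.End ℝ (Family N)) f)

theorem transversal_apply (i j : Fin N) (f : Family N) (I : MultiIndex N) :
    transversal i j f I = if I i = 0 ∧ I j = 0 then f I else 0 := by
  have h : ∀ (k : Fin N) (f : Family N) (I : MultiIndex N),
      (1 - shiftUp k * shiftDown k : Module.End ℝ (Family N)) f I = if I k = 0 then f I else 0 := by
    intro k f I
    change f I - shiftUp k (shiftDown k f) I = _
    rw [shiftUp_shiftDown_apply]
    split_ifs <;> simp
  rw [transversal, h, h, ite_and]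

/-- Integration by parts in both directions, by two uses of `antiVar_eq`. Only the transversal part
contributes to integrals over a flat square. -/
theorem antiVar_antiVar {i j : Fin N} (hij : i ≠ j) (f : Family N) :
    antiVar i (antiVar j f) = totalDer i (shiftDown i (antiVar j f))
      + totalDer j ((1 - shiftUp i * shiftDown i : Module.End ℝ (Family N)) (shiftDown j f))
      + transversal i j f := by
  have hc : Commute (totalDer j) (1 - shiftUp i * shiftDown i : Module.End ℝ (Family N)) := by
    refine (Commute.one_right _).sub_right (Commute.mul_right ?_ ?_)
    · refine (commute_derCoeff_shiftUp j i).add_left ?_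
      refine LinearMap.ext fun f => Finsupp.ext fun J => ?_
      change shiftUp j (shiftUp i f) J = shiftUp i (shiftUp j f) J
      refine DFunLike.congr_fun ?_ J
      refine LinearMap.congr_fun (f := shiftUp j * shiftUp i) (g := shiftUp i * shiftUp j) ?_ f
      refine Finsupp.lhom_ext fun I g => ?_
      simp [add_right_comm]
    · exact (commute_derCoeff_shiftDown j i).add_left (commute_shiftDown_shiftUp hij).symm
  have h1 : ∀ (k : Fin N) (f : Family N), antiVar k f = totalDer k (shiftDown k f)
      + (1 - shiftUp k * shiftDown k : Module.End ℝ (Family N)) f := fun k f =>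
    LinearMap.congr_fun (antiVar_eq k) f
  have h2 : (1 - shiftUp i * shiftDown i : Module.End ℝ (Family N)) (antiVar j f)
      = totalDer j ((1 - shiftUp i * shiftDown i : Module.End ℝ (Family N)) (shiftDown j f))
        + transversal i j f := by
    rw [h1 j, map_add]
    congr 1
    exact (LinearMap.congr_fun hc.eq (shiftDown j f)).symm
  rw [h1 i (antiVar j f), h2, add_assoc]

/-- The base point of the coordinate square with centre `t`. -/
def corner (t : MultiTime N) (i j : Fin N) : MultiTime N :=
  t - ((1 / 2 : ℝ) • Pi.single i 1 + (1 / 2 : ℝ) • Pi.single j 1)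

theorem graphMap_corner (t c : MultiTime N) (i j : Fin N) :
    graphMap (corner t i j) c i j (fun _ => 0) (1 / 2, 1 / 2) = t := by
  simp [graphMap, corner]

theorem center_mem : ((1 / 2, 1 / 2) : ℝ × ℝ) ∈ openSquare := by
  constructor <;> constructor <;> norm_num

variable {n : ℕ} {L : LagrangianTwoForm N n} {u : smoothFun N}

/-- Criticality on flat coordinate squares gives the first Euler–Lagrange equation. -/
theorem varFamily_eq_zero_of_isCriticalOn (h : ∀ S : Surface N, L.IsCriticalOn u.1 S)
    {i j : Fin N} (hij : i ≠ j) {I : MultiIndex N} (hi : I i = 0) (hj : I j = 0) :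
    L.varFamily u i j I = 0 := by
  suffices ∀ t, (transversal i j (L.varFamily u i j) I).1 t = 0 by
    rw [transversal_apply, if_pos ⟨hi, hj⟩] at this
    exact Subtype.ext (funext this)
  intro t
  refine coeff_eq_zero_of_pair_expFun (fun ξ => ?_) I
  have h0 : ContDiff ℝ ∞ fun _ : ℝ × ℝ => (0 : ℝ) := contDiff_const
  let φ : ℝ × ℝ → MultiTime N := graphMap (corner t i j) 0 i j fun _ => 0
  have hφ : ContDiff ℝ ∞ φ := contDiff_graphMap _ _ _ _ h0
  let G := transversal i j (L.varFamily u i j)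
  rw [← graphMap_corner t 0 i j]
  refine eq_zero_of_integral_mul_eq_zero (h := fun x => (pair (expFun ξ) G).1 (φ x))
    ((contDiff_coe _).continuous.comp hφ.continuous) (fun ψ hψ hs => ?_) center_mem
  -- The arbitrary cutoff `ψ` comes out of the transversal part as a factor, while its support
  -- removes all boundary terms.
  let V : smoothFun N := cylinder (corner t i j) i j hψ * expFun ξ
  have hcrit := h (graphSurface (corner t i j) hij rfl rfl h0) V.1 (contDiff_coe V)
    (disjoint_boundary_graphSurface _ (c := 0) hij rfl rfl h0 hs _)
  rw [graphSurface_integral _ hij rfl rfl h0 fun i j t => variation_antisymm L u V i j t] at hcrit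
  simp only [smul_zero, add_zero, sum_single_mul_single] at hcrit
  have hA := coeffFamily_eq L u i j
  rw [antiVar_antiVar hij] at hA
  set a := shiftDown i (antiVar j (L.varFamily u i j))
  set b := (1 - shiftUp i * shiftDown i : Module.End ℝ (Family N))
    (shiftDown j (L.varFamily u i j))
  have hG : pair V G = cylinder (corner t i j) i j hψ * pair (expFun ξ) G := by
    refine pair_cylinder_mul _ hψ _ fun J hJ => ?_
    by_contra hn
    exact hJ (by rw [transversal_apply, if_neg hn])
  have hw : ∀ x, L.variation u.1 V.1 i j (φ x)
      = (fderiv ℝ (fun x => (pair V a).1 (φ x)) x (1, 0)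
        - fderiv ℝ (fun x => -(pair V b).1 (φ x)) x (0, 1))
        + ψ x * (pair (expFun ξ) G).1 (φ x) := by
    intro x
    have e1 : fderiv ℝ (fun x => (pair V a).1 (φ x)) x (1, 0) = partialD i (pair V a).1 (φ x) :=
      (fderiv_comp_graphMap (contDiff_coe _) (corner t i j) 0 i j h0 x (1, 0)).trans
        (by simp [φ])
    have e2 : fderiv ℝ (fun x => -(pair V b).1 (φ x)) x (0, 1)
        = -partialD j (pair V b).1 (φ x) := by
      rw [fderiv_fun_neg]
      exact congr_arg Neg.neg
        ((fderiv_comp_graphMap (contDiff_coe _) (corner t i j) 0 i j h0 x (0, 1)).trans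
          (by simp [φ]))
    rw [variation_eq, hA, map_add, map_add, ← der_pair, ← der_pair, hG, e1, e2, sub_neg_eq_add]
    change _ + _ + (cylinder (corner t i j) i j hψ).1 (φ x) * _ = _
    rw [cylinder_graphMap _ hij rfl rfl]
    rfl
  have hz : ∀ (f : Family N), ∀ x ∉ openSquare, (pair V f).1 (φ x) = 0 := fun f x hx =>
    pair_eq_zero_of_notMem (graphMap_edge_notMem _ hij rfl rfl _ hs _ hx) f
  have hPa : ContDiff ℝ ∞ fun x => (pair V a).1 (φ x) := (contDiff_coe _).comp hφ
  have hPb : ContDiff ℝ ∞ fun x => -(pair V b).1 (φ x) := ((contDiff_coe (pair V b)).comp hφ).neg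
  have hgreen := integral_green_eq_zero hPb hPa (fun x hx => by rw [hz b x hx, neg_zero]) (hz a)
  have hcont : ∀ {F : ℝ × ℝ → ℝ}, ContDiff ℝ ∞ F → ∀ c, Continuous fun x => fderiv ℝ F x c :=
    fun hF c => (hF.continuous_fderiv (by simp)).clm_apply continuous_const
  change ∫ x in unitSquare, L.variation u.1 V.1 i j (φ x) = 0 at hcrit
  simp only [hw] at hcrit
  rwa [MeasureTheory.integral_add, hgreen, zero_add] at hcrit
  · exact integrableOn_unitSquare ((hcont hPa _).sub (hcont hPb _))
  · exact integrableOn_unitSquare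
      (hψ.continuous.mul ((contDiff_coe _).continuous.comp hφ.continuous))

/-! ### Deformations of coordinate squares in a third direction -/

/-- Differentiation of an integral over the unit square with respect to a parameter. -/
theorem integral_deriv_eq_zero {F : ℝ × (ℝ × ℝ) → ℝ} (hF : ContDiff ℝ ∞ F)
    (h : ∀ τ, ∫ x in unitSquare, F (τ, x) = 0) :
    ∫ x in unitSquare, fderiv ℝ F (0, x) (1, 0) = 0 := by
  have hc : Continuous fun y => fderiv ℝ F y (1, 0) :=
    (hF.continuous_fderiv (by simp)).clm_apply continuous_const
  obtain ⟨C, hC⟩ := ((isCompact_Icc (a := (-1 : ℝ)) (b := 1)).prod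
    isCompact_unitSquare).exists_bound_of_continuousOn hc.continuousOn
  have hs : Icc (-1 : ℝ) 1 ∈ nhds (0 : ℝ) := Icc_mem_nhds (by norm_num) (by norm_num)
  have hFc : ∀ τ, Continuous fun x => F (τ, x) := fun τ =>
    hF.continuous.comp (continuous_const.prodMk continuous_id)
  have key := (hasDerivAt_integral_of_dominated_loc_of_deriv_le
    (μ := MeasureTheory.volume.restrict unitSquare) (F := fun τ x => F (τ, x))
    (F' := fun τ x => fderiv ℝ F (τ, x) (1, 0)) (bound := fun _ => C) hs
    (Filter.Eventually.of_forall fun τ => (hFc τ).aestronglyMeasurable)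
    (integrableOn_unitSquare (hFc 0))
    (hc.comp (continuous_const.prodMk continuous_id)).aestronglyMeasurable ?_
    (integrableOn_unitSquare continuous_const) ?_).2
  · simp only [h] at key
    exact key.unique (hasDerivAt_const 0 0)
  · refine (MeasureTheory.ae_restrict_iff' measurableSet_Icc).2 (Filter.Eventually.of_forall ?_)
    exact fun x hx τ hτ => hC (τ, x) ⟨hτ, hx⟩
  · refine Filter.Eventually.of_forall fun x τ _ => ?_
    exact (hF.differentiable (by simp) (τ, x)).hasFDerivAt.comp_hasDerivAt τ
      ((hasDerivAt_id τ).prodMk (hasDerivAt_const τ x))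

/-- The integral of an antisymmetric two-form over graphs in a coordinate direction. -/
theorem sum_graph_single {w : Fin N → Fin N → ℝ} (hw : ∀ i j, w j i = -w i j) (i j k : Fin N)
    (a b : ℝ) :
    ∑ k', ∑ l, w k' l * (((Pi.single i 1 + a • Pi.single k 1 : MultiTime N) k') *
      ((Pi.single j 1 + b • Pi.single k 1 : MultiTime N) l))
      = w i j + b * w i k + a * w k j := by
  have hk : w k k = 0 := by linarith [hw k k]
  have h : ∀ k' l, w k' l * (((Pi.single i 1 + a • Pi.single k 1 : MultiTime N) k') *
      ((Pi.single j 1 + b • Pi.single k 1 : MultiTime N) l))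
      = w k' l * ((Pi.single i 1 : MultiTime N) k' * (Pi.single j 1 : MultiTime N) l)
        + b * (w k' l * ((Pi.single i 1 : MultiTime N) k' * (Pi.single k 1 : MultiTime N) l))
        + a * (w k' l * ((Pi.single k 1 : MultiTime N) k' * (Pi.single j 1 : MultiTime N) l))
        + a * b * (w k' l * ((Pi.single k 1 : MultiTime N) k' * (Pi.single k 1 : MultiTime N) l)) := by
    intro k' l
    simp only [Pi.add_apply, Pi.smul_apply, smul_eq_mul]
    ring
  simp only [h, Finset.sum_add_distrib, ← Finset.mul_sum, sum_single_mul_single, hk]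
  ring

/-- If a two-form has vanishing integral over all small deformations of a coordinate square in the
direction of the coordinate `k`, then its exterior derivative vanishes on the square. -/
theorem exterior_eq_zero_of_integral_graph {W : Fin N → Fin N → MultiTime N → ℝ}
    (hW : ∀ i j, ContDiff ℝ ∞ (W i j)) (hanti : ∀ i j t, W j i t = -W i j t) (p : MultiTime N)
    {i j k : Fin N} (hij : i ≠ j) (hki : (Pi.single k 1 : MultiTime N) i = 0)
    (hkj : (Pi.single k 1 : MultiTime N) j = 0)
    (hz : ∀ i' j', ∀ x ∉ openSquare, W i' j' (graphMap p (Pi.single k 1) i j (fun _ => 0) x) = 0)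
    (h : ∀ f : ℝ × ℝ → ℝ, ∀ hf : ContDiff ℝ ∞ f,
      (graphSurface p hij hki hkj hf).integral W = 0) {x : ℝ × ℝ} (hx : x ∈ openSquare) :
    (fun t => partialD i (W j k) t + partialD j (W k i) t + partialD k (W i j) t)
      (graphMap p (Pi.single k 1) i j (fun _ => 0) x) = 0 := by
  have h0 : ContDiff ℝ ∞ fun _ : ℝ × ℝ => (0 : ℝ) := contDiff_const
  let φ : ℝ × ℝ → MultiTime N := graphMap p (Pi.single k 1) i j fun _ => 0
  have hφ : ContDiff ℝ ∞ φ := contDiff_graphMap _ _ _ _ h0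
  have hWφ : ∀ i' j', ContDiff ℝ ∞ fun x => W i' j' (φ x) := fun i' j' => (hW i' j').comp hφ
  have hdW : ∀ l i' j', Continuous fun x => partialD l (W i' j') (φ x) := fun l i' j' =>
    (contDiff_partialD l (hW i' j')).continuous.comp hφ.continuous
  refine eq_zero_of_integral_mul_eq_zero (h := fun x => partialD i (W j k) (φ x)
    + partialD j (W k i) (φ x) + partialD k (W i j) (φ x))
    (((hdW i j k).add (hdW j k i)).add (hdW k i j)) (fun f hf _ => ?_) hx
  have hcont : ∀ c, ContDiff ℝ ∞ fun x => fderiv ℝ f x c :=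
    fun c => (hf.fderiv_right (m := ∞) (by simp)).clm_apply contDiff_const
  let Φ : ℝ × (ℝ × ℝ) → MultiTime N := fun y => φ y.2 + (y.1 * f y.2) • Pi.single k 1
  have hΦ : ContDiff ℝ ∞ Φ := (hφ.comp contDiff_snd).add
    ((contDiff_fst.mul (hf.comp contDiff_snd)).smul contDiff_const)
  -- The integrand of the pullback of `W` to the graph of `τ f`, with `τ = y.1`.
  let F : ℝ × (ℝ × ℝ) → ℝ := fun y => W i j (Φ y)
    + y.1 * (fderiv ℝ f y.2 (0, 1) * W i k (Φ y) + fderiv ℝ f y.2 (1, 0) * W k j (Φ y))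
  have hF : ContDiff ℝ ∞ F := ((hW i j).comp hΦ).add (contDiff_fst.mul
    ((((hcont _).comp contDiff_snd).mul ((hW i k).comp hΦ)).add
      (((hcont _).comp contDiff_snd).mul ((hW k j).comp hΦ))))
  have hint : ∀ τ, ∫ x in unitSquare, F (τ, x) = 0 := by
    intro τ
    have hτ : ContDiff ℝ ∞ fun x => τ * f x := contDiff_const.mul hf
    rw [← h _ hτ, graphSurface_integral p hij hki hkj hτ hanti]
    congr 1
    funext x
    have hg : graphMap p (Pi.single k 1) i j (fun x => τ * f x) x = Φ (τ, x) := by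
      simp only [graphMap, Φ, φ, zero_smul, add_zero, add_assoc]
    have hd : ∀ c, fderiv ℝ (fun x => τ * f x) x c = τ * fderiv ℝ f x c := by
      intro c
      rw [fderiv_const_mul (hf.differentiable (by simp) x)]
      rfl
    rw [sum_graph_single (w := fun k' l => W k' l _) fun i j => hanti i j _, hg, hd, hd]
    simp only [F]
    ring
  have hderiv := integral_deriv_eq_zero hF hint
  have hval : ∀ x, fderiv ℝ F (0, x) (1, 0) = f x * partialD k (W i j) (φ x)
      + (fderiv ℝ f x (0, 1) * W i k (φ x) + fderiv ℝ f x (1, 0) * W k j (φ x)) := by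
    intro x
    have hline : HasDerivAt (fun τ : ℝ => ((τ, x) : ℝ × (ℝ × ℝ))) (1, 0) 0 :=
      (hasDerivAt_id _).prodMk (hasDerivAt_const _ _)
    have h1 := (hF.differentiable (by simp) (0, x)).hasFDerivAt.comp_hasDerivAt 0 hline
    have hΦ0 : Φ (0, x) = φ x := by simp [Φ]
    have h2 : HasDerivAt (fun τ : ℝ => Φ (τ, x)) (f x • Pi.single k 1) 0 := by
      have := (((hasDerivAt_id (0 : ℝ)).mul_const (f x)).smul_const
        (Pi.single k 1 : MultiTime N)).const_add (φ x)
      simpa only [id_eq, one_mul] using this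
    have h3 : HasDerivAt (fun τ : ℝ => W i j (Φ (τ, x))) (f x * partialD k (W i j) (φ x)) 0 := by
      have := ((hW i j).differentiable (by simp) (Φ (0, x))).hasFDerivAt.comp_hasDerivAt 0 h2
      rw [map_smul, hΦ0] at this
      exact this
    -- This is the factor multiplied by `τ` in `F`: at `τ = 0` only its value enters the derivative,
    -- so mere differentiability suffices.
    let R : ℝ → ℝ := fun τ => fderiv ℝ f x (0, 1) * W i k (Φ (τ, x))
      + fderiv ℝ f x (1, 0) * W k j (Φ (τ, x))
    have h4 : DifferentiableAt ℝ R 0 := by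
      have hl : ContDiff ℝ ∞ fun τ : ℝ => Φ (τ, x) :=
        hΦ.comp (contDiff_id.prodMk contDiff_const)
      exact ((contDiff_const.mul ((hW i k).comp hl)).add
        (contDiff_const.mul ((hW k j).comp hl))).differentiable (n := ∞) (by simp) 0
    have h5 := h3.add ((hasDerivAt_id (0 : ℝ)).mul h4.hasDerivAt)
    have h6 := h1.unique h5
    rw [h6]
    simp [R, hΦ0]
  -- Chosen so that the Green integrand absorbs the derivatives of `f`; what remains is `f` times
  -- the exterior derivative of `W`.
  let Q : ℝ × ℝ → ℝ := fun x => f x * W k j (φ x)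
  let P : ℝ × ℝ → ℝ := fun x => -(f x * W i k (φ x))
  have hQ : ContDiff ℝ ∞ Q := hf.mul (hWφ k j)
  have hP : ContDiff ℝ ∞ P := (hf.mul (hWφ i k)).neg
  have hgreen := integral_green_eq_zero hP hQ
    (fun x hx => by simp only [P, φ, hz _ _ x hx, mul_zero, neg_zero])
    (fun x hx => by simp only [Q, φ, hz _ _ x hx, mul_zero])
  have hdP : ∀ i' j' x c, fderiv ℝ (fun x => f x * W i' j' (φ x)) x c
      = fderiv ℝ f x c * W i' j' (φ x)
        + f x * (c.1 * partialD i (W i' j') (φ x) + c.2 * partialD j (W i' j') (φ x)) := by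
    intro i' j' x c
    have e := fderiv_comp_graphMap (hW i' j') p (Pi.single k 1) i j h0 x c
    rw [fderiv_fun_mul (hf.differentiable (by simp) x) ((hWφ i' j').differentiable (by simp) x)]
    change f x * fderiv ℝ (fun x => W i' j' (φ x)) x c + W i' j' (φ x) * fderiv ℝ f x c = _
    rw [e]
    simp [φ]
    ring
  have hneg : ∀ i' j' l t, partialD l (W j' i') t = -partialD l (W i' j') t := by
    intro i' j' l t
    have : W j' i' = fun t => -W i' j' t := funext fun t => hanti i' j' t
    rw [partialD, this, fderiv_fun_neg]
    rfl
  have hsub : ∀ x, f x * (partialD i (W j k) (φ x) + partialD j (W k i) (φ x)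
      + partialD k (W i j) (φ x)) = fderiv ℝ F (0, x) (1, 0)
        - (fderiv ℝ Q x (1, 0) - fderiv ℝ P x (0, 1)) := by
    intro x
    have hP' : fderiv ℝ P x (0, 1) = -fderiv ℝ (fun x => f x * W i k (φ x)) x (0, 1) := by
      simp only [P]
      rw [fderiv_fun_neg]
      rfl
    rw [hval, hP', hdP, hdP, hneg k j, hneg i k]
    ring
  have hcF : ∀ c, Continuous fun x => fderiv ℝ F (0, x) c := fun c =>
    ((hF.continuous_fderiv (by simp)).comp (continuous_const.prodMk continuous_id)).clm_apply
      continuous_const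
  have hc2 : ∀ {G : ℝ × ℝ → ℝ}, ContDiff ℝ ∞ G → ∀ c, Continuous fun x => fderiv ℝ G x c :=
    fun hG c => (hG.continuous_fderiv (by simp)).clm_apply continuous_const
  simp only [hsub]
  rw [MeasureTheory.integral_sub, hderiv, hgreen, sub_zero]
  · exact integrableOn_unitSquare (hcF _)
  · exact integrableOn_unitSquare ((hc2 hQ _).sub (hc2 hP _))

/-- There is a cutoff function in the open unit square. -/
theorem exists_cutoff : ∃ ψ : ℝ × ℝ → ℝ, ContDiff ℝ ∞ ψ ∧ tsupport ψ ⊆ openSquare ∧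
    ψ =ᶠ[nhds (1 / 2, 1 / 2)] 1 := by
  -- The closed ball of radius `1 / 4` for the maximum norm lies in the open square.
  let f : ContDiffBump ((1 / 2, 1 / 2) : ℝ × ℝ) := ⟨1 / 8, 1 / 4, by norm_num, by norm_num⟩
  refine ⟨f, f.contDiff, ?_, f.eventuallyEq_one⟩
  rw [f.tsupport_eq]
  intro x hx
  rw [Metric.mem_closedBall, Prod.dist_eq, max_le_iff, Real.dist_eq, Real.dist_eq, abs_le,
    abs_le] at hx
  obtain ⟨⟨h1, h2⟩, h3, h4⟩ := hx
  simp only [f] at h1 h2 h3 h4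
  refine ⟨⟨?_, ?_⟩, ?_, ?_⟩ <;> linarith

/-- Criticality on graphs over coordinate squares makes the two-form of operators closed. -/
theorem closed_of_isCriticalOn (h : ∀ S : Surface N, L.IsCriticalOn u.1 S)
    {i j k : Fin N} (hij : i ≠ j) (hjk : j ≠ k) (hik : i ≠ k) :
    totalDer i (L.coeffFamily u j k) + totalDer j (L.coeffFamily u k i)
      + totalDer k (L.coeffFamily u i j) = 0 := by
  refine Finsupp.ext fun I => Subtype.ext (funext fun t => ?_)
  refine coeff_eq_zero_of_pair_expFun (fun ξ => ?_) I
  obtain ⟨ψ, hψ, hs, h1⟩ := exists_cutoff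
  let p := corner t i j
  let V : smoothFun N := cylinder p i j hψ * expFun ξ
  have hki : (Pi.single k 1 : MultiTime N) i = 0 := Pi.single_eq_of_ne hik 1
  have hkj : (Pi.single k 1 : MultiTime N) j = 0 := Pi.single_eq_of_ne hjk 1
  -- The cutoff equals one near the centre of the square, so localizing leaves the jet of the
  -- exponential at `t` unchanged.
  have hV : (expFun ξ).1 =ᶠ[nhds t] V.1 := by
    have hc : Continuous fun s : MultiTime N => (s i - p i, s j - p j) := by fun_prop
    have ht : (t i - p i, t j - p j) = ((1 / 2, 1 / 2) : ℝ × ℝ) := by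
      simp [p, corner, hij, hij.symm]
    rw [← ht] at h1
    filter_upwards [hc.continuousAt.eventually h1] with s hs
    change (expFun ξ).1 s = ψ (s i - p i, s j - p j) * (expFun ξ).1 s
    rw [hs, Pi.one_apply, one_mul]
  rw [pair_congr hV, map_add, map_add, ← der_pair, ← der_pair, ← der_pair]
  have key := exterior_eq_zero_of_integral_graph
    (W := fun i j => (pair V (L.coeffFamily u i j)).1) (fun i j => contDiff_coe _)
    (fun i j t => by rw [coeffFamily_antisymm, map_neg]; rfl) p hij hki hkj
    (fun i' j' x hx => pair_eq_zero_of_notMem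
      (graphMap_edge_notMem p hij hki hkj _ hs _ hx) _)
    (fun f hf => by
      rw [← h (graphSurface p hij hki hkj hf) V.1 (contDiff_coe V)
        (disjoint_boundary_graphSurface p hij hki hkj hf hs _)]
      exact Surface.integral_congr _ fun i j _ => (variation_eq L u V i j).symm)
    center_mem
  rw [graphMap_corner] at key
  exact key

theorem eulerLagrange_of_isCriticalOn (h : ∀ S : Surface N, L.IsCriticalOn u.1 S) :
    EulerLagrange (L.varFamily u) :=
  eulerLagrange_of_koszul (varFamily_antisymm L u)
    (fun _ _ hij _ hi hj => varFamily_eq_zero_of_isCriticalOn h hij hi hj)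
    fun _ _ _ hij hjk hik => koszul_of_closed (fun i j _ => coeffFamily_eq L u i j) hij hjk hik
      (closed_of_isCriticalOn h hij hjk hik)

theorem eulerLagrange_iff (L : LagrangianTwoForm N n) (u : smoothFun N) :
    EulerLagrange (L.varFamily u) ↔
      (∀ i j : Fin N, i ≠ j → ∀ I : MultiIndex N, I i = 0 → I j = 0 →
        ∀ t, L.varDerivOn u.1 i j I t = 0) ∧
      (∀ i j k : Fin N, i ≠ j → j ≠ k → i ≠ k → ∀ I : MultiIndex N, I i = 0 →
        ∀ t, L.varDerivOn u.1 i j (I + Pi.single j 1) t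
          = L.varDerivOn u.1 i k (I + Pi.single k 1) t) ∧
      (∀ i j k : Fin N, i ≠ j → j ≠ k → i ≠ k → ∀ I : MultiIndex N,
        ∀ t, L.varDerivOn u.1 i j (I + Pi.single i 1 + Pi.single j 1) t
          + L.varDerivOn u.1 j k (I + Pi.single j 1 + Pi.single k 1) t
          + L.varDerivOn u.1 k i (I + Pi.single k 1 + Pi.single i 1) t = 0) := by
  simp only [← varFamily_apply, EulerLagrange, Subtype.ext_iff, funext_iff]
  rfl

end PluriLagrangian

end

open PluriLagrangian
theorem mainTheorem2 (N n : ℕ) (L : LagrangianTwoForm N n)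
    (u : MultiTime N → ℝ) (hu : ContDiff ℝ ∞ u) :
    L.SolvesPluriLagrangianProblem u ↔
      (∀ i j : Fin N, i ≠ j → ∀ I : MultiIndex N, I i = 0 → I j = 0 →
        ∀ t, L.varDerivOn u i j I t = 0) ∧
      (∀ i j k : Fin N, i ≠ j → j ≠ k → i ≠ k → ∀ I : MultiIndex N, I i = 0 →
        ∀ t, L.varDerivOn u i j (I + Pi.single j 1) t
          = L.varDerivOn u i k (I + Pi.single k 1) t) ∧
      (∀ i j k : Fin N, i ≠ j → j ≠ k → i ≠ k → ∀ I : MultiIndex N,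
        ∀ t, L.varDerivOn u i j (I + Pi.single i 1 + Pi.single j 1) t
          + L.varDerivOn u j k (I + Pi.single j 1 + Pi.single k 1) t
          + L.varDerivOn u k i (I + Pi.single k 1 + Pi.single i 1) t = 0) := by
  rw [← eulerLagrange_iff L ⟨u, hu⟩]
  exact ⟨fun h => eulerLagrange_of_isCriticalOn h,
    fun h S => isCriticalOn_of_eulerLagrange L ⟨u, hu⟩ h S⟩
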